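/- **Conventions.** For a nonempty finite set $S\subseteq\{0,1\}^n$ let $|S\rangle=|S|^{-1/2}\sum_{x\in S}|x\rangle$. For $X=\{x_1,\dots,x_k\}\subseteq\{0,1\}^n$ with $|X|=k$ let $|\sigma_X\rangle=(k!)^{-1/2}\sum_{\pi\in S_k}|x_{\pi(1)},\dots,x_{\pi(k)}\rangle$. The membership oracle $O_S$ is the unitary $|x\rangle|y\rangle\mapsto|x\rangle|y\oplus 1_S(x)\rangle$. A $q$-query quantum oracle algorithm applies $U_qO_SU_{q-1}\cdots U_1O_SU_0$ to its input state tensored with a fixed state of its remaining registers (query, answer and a finite-dimensional workspace), where $U_0,\dots,U_q$ are arbitrary fixed unitaries on all registers (not depending on $S$), then measures and outputs a function of the measurement result. A function $f:\mathbb N\to\mathbb R$ is negligible if $n^c f(n)\to0$ for every $c\in\mathbb N$, and $f:\mathbb N\to\mathbb N$ is superpolynomial if for every $c$, $f(n)\ge n^c$ for all large $n$. For integers $1\le k<s<t\le 2^n$ and $q\ge0$ put $$B(n,k,s,t,q)=q\sqrt{\frac{t-s}{2^n}}+q\sqrt{\frac{t-k}{2^n}}+\frac{k}{\sqrt s}+\frac{sk}{t}.$$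 **Theorem ($k\mapsto k+1$ unforgeability of subset states).** 1. There is an absolute constant $C>0$ such that for all integers $n,q\ge0$ and $1\le k<s<t\le 2^n$ and every $q$-query quantum oracle algorithm $\mathcal A$ with output in $(\{0,1\}^n)^{k+1}$, $$\Pr_{S\subseteq\{0,1\}^n,\ |S|=s}\Big[x_1,\dots,x_{k+1}\text{ are pairwise distinct elements of }S\ :\ (x_1,\dots,x_{k+1})\leftarrow\mathcal A^{O_S}(|S\rangle^{\otimes k})\Big]\le C\cdot B(n,k,s,t,q),$$ where $S$ is a uniformly random subset of size $s$. 2. There is an absolute constant $C>0$ such that for all integers $n,q\ge0$ and $1\le k<s<t\le 2^n$ and every $q$-query quantum oracle algorithm $\mathcal D$ with one-bit output, $$\left|\Pr_{S\subseteq\{0,1\}^n,\ |S|=s}\big[\mathcal D^{O_S}(|S\rangle^{\otimes k})=1\big]-\Pr_{X\subseteq\{0,1\}^n,\ |X|=k}\big[\mathcal D^{O_X}(|\sigma_X\rangle)=1\big]\right|\le C\cdot B(n,k,s,t,q),$$ where $S$ and $X$ are uniformly random subsets of the indicated sizes. 3. Let $k(n),q(n)$ be polynomially bounded and $s(n),t(n)$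 superpolynomial with $1\le k(n)<s(n)<t(n)\le2^n$ for all large $n$, and suppose that $s(n)/t(n)$ and $t(n)/2^n$ are negligible. Then for every sequence of $q(n)$-query quantum oracle algorithms $\mathcal A_n$, the probability in part 1 (for $\mathcal A_n$, $k(n)$, $s(n)$) is a negligible function of $n$. -/

import Mathlib

open Filter Topology
open scoped BigOperators

noncomputable section

/-- Bit strings of length `n`, i.e. the set `{0,1}^n`. -/
abbrev BitString (n : ℕ) : Type := Fin n → Bool

/-- The finite-dimensional Hilbert space with computational basis indexed by `ι`. -/
abbrev Ket (ι : Type) [Fintype ι] : Type := EuclideanSpace ℂ ι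

/-- The subset state `|S⟩ = |S|^{-1/2} ∑_{x ∈ S} |x⟩`. -/
def subsetKet {n : ℕ} (S : Finset (BitString n)) : Ket (BitString n) :=
  WithLp.toLp 2 fun x => if x ∈ S then (((√(S.card : ℝ))⁻¹ : ℝ) : ℂ) else 0

/-- The product state `|ψ⟩^{⊗ k}` on `k` copies of a register. -/
def tensorPower {ι : Type} [Fintype ι] (ψ : Ket ι) (k : ℕ) : Ket (Fin k → ι) :=
  WithLp.toLp 2 fun a => ∏ i, ψ (a i)

/-- The product state `|φ⟩ ⊗ |ψ⟩`. -/
def tensorKet {ι κ : Type} [Fintype ι] [Fintype κ] (φ : Ket ι) (ψ : Ket κ) : Ket (ι × κ) :=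
  WithLp.toLp 2 fun p => φ p.1 * ψ p.2

/-- For `X` with `k` elements, the state `|σ_X⟩`: the uniform superposition of the `k!` orderings
of `X`, that is, of the injective `k`-tuples whose set of entries is `X`; see `sigmaKet_image`
for the form `(k!)^{-1/2} ∑_{σ ∈ S_k} |x_{σ(1)}, …, x_{σ(k)}⟩`. -/
def sigmaKet {n : ℕ} (k : ℕ) (X : Finset (BitString n)) : Ket (Fin k → BitString n) :=
  open Classical in
  WithLp.toLp 2 fun a =>
    if Function.Injective a ∧ Finset.univ.image a = X then
      (((√(k.factorial : ℝ))⁻¹ : ℝ) : ℂ) else 0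

theorem sigmaKet_image {n k : ℕ} (x : Fin k → BitString n) (hx : Function.Injective x) :
    sigmaKet k (Finset.univ.image x) =
      (((√(k.factorial : ℝ))⁻¹ : ℝ) : ℂ) •
        ∑ σ : Equiv.Perm (Fin k), EuclideanSpace.single (x ∘ σ) (1 : ℂ) := by
  classical
  ext a
  simp only [sigmaKet, PiLp.smul_apply, WithLp.ofLp_sum, Finset.sum_apply, smul_eq_mul,
    PiLp.single_apply]
  split_ifs with h
  · obtain ⟨ha, him⟩ := h
    have hex : ∀ i, ∃ j, x j = a i := fun i => by
      have : a i ∈ Finset.univ.image x := by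
        rw [← him]; exact Finset.mem_image_of_mem _ (Finset.mem_univ i)
      simpa using this
    choose g hg using hex
    have hgi : Function.Injective g := fun i j hij => ha (by rw [← hg i, ← hg j, hij])
    let τ : Equiv.Perm (Fin k) := Equiv.ofBijective g (Finite.injective_iff_bijective.mp hgi)
    have hτ : ∀ σ : Equiv.Perm (Fin k), a = x ∘ σ ↔ σ = τ := by
      intro σ
      constructor
      · intro h
        ext i
        have h1 : x (σ i) = x (g i) := by
          rw [hg i]; exact (congrFun h i).symm
        exact congrArg Fin.val (hx h1)
      · rintro rfl
        funext i
        exact (hg i).symm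
    simp [hτ]
  · rw [Finset.sum_eq_zero, mul_zero]
    intro σ _
    rw [if_neg]
    rintro rfl
    apply h
    refine ⟨hx.comp σ.injective, ?_⟩
    ext y
    simp only [Finset.mem_image, Finset.mem_univ, true_and, Function.comp]
    exact ⟨fun ⟨i, hi⟩ => ⟨σ i, hi⟩, fun ⟨i, hi⟩ => ⟨σ.symm i, by simpa using hi⟩⟩

/-- Computational basis of the registers of an algorithm: the input register holding `k`
strings of `n` bits, the `n`-qubit query register, the one-qubit answer register, and a
workspace of dimension `w`. -/
abbrev RegisterBasis (n k w : ℕ) : Type :=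
  (Fin k → BitString n) × (BitString n × Bool × Fin w)

/-- The permutation `(x, y) ↦ (x, y ⊕ f(x))` of the basis labels of the query and answer
registers, which leaves the other registers alone. -/
def oraclePerm {n k w : ℕ} (f : BitString n → Bool) : Equiv.Perm (RegisterBasis n k w) :=
  Function.Involutive.toPerm
    (fun b => (b.1, (b.2.1, (xor b.2.2.1 (f b.2.1), b.2.2.2)))) (by
      rintro ⟨a, x, y, z⟩
      simp)

/-- The unitary oracle gate `|x⟩|y⟩ ↦ |x⟩|y ⊕ f(x)⟩`. -/
def oracleGate {n k w : ℕ} (f : BitString n → Bool) :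
    Ket (RegisterBasis n k w) ≃ₗᵢ[ℂ] Ket (RegisterBasis n k w) :=
  LinearIsometryEquiv.piLpCongrLeft 2 ℂ ℂ (oraclePerm f)

/-- The indicator function of `S`, whose oracle gate is the membership oracle `O_S`. -/
def membership {n : ℕ} (S : Finset (BitString n)) : BitString n → Bool :=
  fun x => decide (x ∈ S)

/-- A quantum oracle algorithm with `q` queries to a function `{0,1}^n → {0,1}`, whose input
is a state of `k` registers of `n` qubits and whose output lies in `α`: a workspace, an initial
state of all registers other than the input, unitaries `U_0, …, U_q` on all registers, and
a measurement of all registers in the computational basis at the end whose result is mapped to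
an output. No cost other than the number of queries is restricted. -/
structure QueryAlgorithm (n k q : ℕ) (α : Type) where
  /-- dimension of the workspace -/
  w : ℕ
  /-- initial state of query register, answer register and workspace -/
  init : Ket (BitString n × Bool × Fin w)
  norm_init : ‖init‖ = 1
  /-- the unitaries applied before, between and after the queries -/
  U : Fin (q + 1) → (Ket (RegisterBasis n k w) ≃ₗᵢ[ℂ] Ket (RegisterBasis n k w))
  /-- classical post-processing of the measurement result -/
  out : RegisterBasis n k w → α

namespace QueryAlgorithm

variable {n k q : ℕ} {α : Type}

/-- The state `U_i O_f U_{i-1} ⋯ U_1 O_f U_0 (|φ⟩ ⊗ |init⟩)`, after `i` queries. -/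
def state (A : QueryAlgorithm n k q α) (f : BitString n → Bool) (φ : Ket (Fin k → BitString n)) :
    Fin (q + 1) → Ket (RegisterBasis n k A.w) :=
  Fin.induction (motive := fun _ => Ket (RegisterBasis n k A.w))
    (A.U 0 (tensorKet φ A.init)) (fun i ψ => A.U i.succ (oracleGate f ψ))

open Classical in
/-- The probability that `A`, run on input `φ` with oracle `f`, gives an output in `E`. -/
def prob (A : QueryAlgorithm n k q α) (f : BitString n → Bool) (φ : Ket (Fin k → BitString n))
    (E : Set α) : ℝ :=
  ∑ b with A.out b ∈ E, ‖A.state f φ (Fin.last q) b‖ ^ 2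

end QueryAlgorithm

/-- `dist(S, m)`: the `m`-tuples of pairwise distinct elements of `S`. -/
def distTuples {n : ℕ} (S : Finset (BitString n)) (m : ℕ) : Set (Fin m → BitString n) :=
  {x | Function.Injective x ∧ ∀ i, x i ∈ S}

/-- The probability, over a uniformly random `S ⊆ {0,1}^n` with `|S| = s` and over the run of
`A`, that `A` on input `|S⟩^{⊗ k}` with membership oracle `O_S` outputs `k + 1` distinct
elements of `S`. -/
def forgeProb {n k q : ℕ} (s : ℕ) (A : QueryAlgorithm n k q (Fin (k + 1) → BitString n)) : ℝ :=
  Finset.expect (Finset.powersetCard s (Finset.univ : Finset (BitString n)))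
    fun S => A.prob (membership S) (tensorPower (subsetKet S) k) (distTuples S (k + 1))

/-- The probability that `D` outputs `1` on input `|S⟩^{⊗ k}` with oracle `O_S`, for a uniformly
random `S ⊆ {0,1}^n` with `|S| = s`. -/
def subsetAcceptProb {n k q : ℕ} (s : ℕ) (D : QueryAlgorithm n k q Bool) : ℝ :=
  Finset.expect (Finset.powersetCard s (Finset.univ : Finset (BitString n)))
    fun S => D.prob (membership S) (tensorPower (subsetKet S) k) {true}

/-- The probability that `D` outputs `1` on input `|σ_X⟩` with oracle `O_X`, for a uniformly
random `X ⊆ {0,1}^n` with `|X| = k`. -/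
def sigmaAcceptProb {n k q : ℕ} (D : QueryAlgorithm n k q Bool) : ℝ :=
  Finset.expect (Finset.powersetCard k (Finset.univ : Finset (BitString n)))
    fun X => D.prob (membership X) (sigmaKet k X) {true}

/-- The expression inside the `O(·)`. -/
def forgeBound (n k s t q : ℕ) : ℝ :=
  q * √(((t : ℝ) - s) / 2 ^ n) + q * √(((t : ℝ) - k) / 2 ^ n) + k / √(s : ℝ) + (s : ℝ) * k / t

/-- `f(n)` is negligible: it is `o(n^{-c})` for every `c`. -/
def Negligible (f : ℕ → ℝ) : Prop :=
  Asymptotics.SuperpolynomialDecay atTop (fun n : ℕ => (n : ℝ)) f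

/-- `f(n) = poly(n)`: at most polynomial growth. -/
def PolyBounded (f : ℕ → ℕ) : Prop := ∃ c : ℕ, ∀ᶠ n in atTop, f n ≤ n ^ c

/-- `f(n) = n^{ω(1)}`: eventually larger than every polynomial. -/
def Superpolynomial (f : ℕ → ℕ) : Prop := ∀ c : ℕ, ∀ᶠ n in atTop, n ^ c ≤ f n

end

/-!
Fix a random set `S` with `|S| = s` and hide it in a random `T ⊇ S` with `|T| = t`.

*From `S` to `T`.* Given `S`, the set `T \ S` is a random set of strings outside `S`, so each query
of a run with oracle `O_S` puts weight at most `(t - s) / (2^n - s)` on it on average. The hybrid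
argument (`QueryAlgorithm.abs_prob_sub_expect_prob_le`) therefore allows `O_T` in place of `O_S`.
By double counting (`expect_powersetCard_extend`), `T` may be drawn first, and then `S ⊆ T` at
random. For fixed `T` the whole algorithm is a fixed isometry followed by a measurement, and only
the input copies of `|S⟩` and the winning event depend on `S`. Up to collisions, of weight at most
`k² / s`, these copies are the uniform superposition `distinctKet` of the orthonormal states
`|σ_X⟩` with `X ⊆ S`, `|X| = k`.

*Indistinguishability.* Averaged over `S ⊆ T`, the density matrix of `distinctKet` is a multiple of
the kernel `(X, X') ↦ #{S : X ∪ X' ⊆ S}`. By Vandermonde's identity this kernel is a nonnegative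
combination of the kernels `[Y ⊆ X ∩ X']`, and its part with `|Y| = k` is a multiple of the identity
carrying all but `O(k² / s + s k / t)` of the trace (`choose_mul_sum_norm_sq_le`). Hence the state
is close to the uniform mixture of the `|σ_X⟩` with `X ⊆ T`. A second use of the hybrid argument
replaces `O_T` by `O_X`.

*Unforgeability.* Verifying the forged tuple with oracle queries would cost a term that the bound
does not contain, so the forging probability is bounded directly for each `T`. Let the elements of
`S ⊆ T` first be chosen independently with probability `p ≈ s / t`. The amplitude of a measurement
outcome is `∑_{X ⊆ S} c_X`; expand it in the `p`-biased characters `biasedChar`. The part of degree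
below `k` has total weight `O(k p)` (`sum_norm_lower_sq_le`). The part of degree `k` behaves like a
mixture over `X`: an outcome naming `k + 1` points names one outside `X`, and that point lies in `S`
with probability only `p` (`sum_norm_top_sq_le`). Finally, the size of this random `S` is within
`O(√s)` of its mean with constant probability, and adding `O(√s)` elements to a set of size `s`
moves `distinctKet` by a squared distance of `O(k / √s)` only, which carries the bound over to sets
of size exactly `s` (`expect_weight_distinctKet_forge_le`).
-/

noncomputable section

/-! ### Measurement weights -/

/-- The weight that a measurement of `ψ` in the computational basis puts on the set `F` of
outcomes. It is a probability when `ψ` is a unit vector. -/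
def weight {ι : Type} [Fintype ι] (F : Finset ι) (ψ : Ket ι) : ℝ := ∑ b ∈ F, ‖ψ b‖ ^ 2

/-- The orthogonal projection of `ψ` to the span of the basis vectors satisfying `P`. -/
def truncate {ι : Type} [Fintype ι] (P : ι → Prop) (ψ : Ket ι) : Ket ι :=
  open Classical in WithLp.toLp 2 fun b => if P b then ψ b else 0

section Weight

variable {ι : Type} [Fintype ι]

lemma weight_univ (ψ : Ket ι) : weight Finset.univ ψ = ‖ψ‖ ^ 2 := by
  rw [EuclideanSpace.norm_sq_eq]; rfl

lemma weight_nonneg (F : Finset ι) (ψ : Ket ι) : 0 ≤ weight F ψ :=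
  Finset.sum_nonneg fun _ _ => by positivity

lemma weight_mono {F G : Finset ι} (h : F ⊆ G) (ψ : Ket ι) : weight F ψ ≤ weight G ψ :=
  Finset.sum_le_sum_of_subset_of_nonneg h fun _ _ _ => by positivity

lemma weight_le_norm_sq (F : Finset ι) (ψ : Ket ι) : weight F ψ ≤ ‖ψ‖ ^ 2 := by
  rw [← weight_univ]; exact weight_mono (Finset.subset_univ _) _

lemma weight_compl [DecidableEq ι] (F : Finset ι) (ψ : Ket ι) :
    weight Fᶜ ψ = ‖ψ‖ ^ 2 - weight F ψ := by
  rw [← weight_univ, weight, weight, weight, ← Finset.sum_add_sum_compl F]; ring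

lemma weight_eq_norm_truncate_sq (F : Finset ι) (ψ : Ket ι) :
    weight F ψ = ‖truncate (· ∈ F) ψ‖ ^ 2 := by
  classical
  have h : ∀ b, ‖truncate (· ∈ F) ψ b‖ ^ 2 = if b ∈ F then ‖ψ b‖ ^ 2 else 0 := fun b => by
    simp only [truncate]; split_ifs <;> simp
  rw [EuclideanSpace.norm_sq_eq, weight, Finset.sum_congr rfl fun b _ => h b]
  simp

lemma truncate_sub (P : ι → Prop) (ψ χ : Ket ι) :
    truncate P ψ - truncate P χ = truncate P (ψ - χ) := by
  ext b; simp only [truncate, PiLp.sub_apply]; split_ifs <;> simp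

lemma norm_truncate_mem_le (F : Finset ι) (ψ : Ket ι) : ‖truncate (· ∈ F) ψ‖ ≤ ‖ψ‖ := by
  have := weight_le_norm_sq F ψ
  rw [weight_eq_norm_truncate_sq] at this
  exact le_of_sq_le_sq this (norm_nonneg _)

/-- Small weights are stable to first order in the squared distance; `abs_weight_sub_weight_le`
would lose a square root. -/
lemma weight_le_two_mul_add (F : Finset ι) (ψ χ : Ket ι) :
    weight F ψ ≤ 2 * weight F χ + 2 * ‖ψ - χ‖ ^ 2 := by
  rw [weight_eq_norm_truncate_sq, weight_eq_norm_truncate_sq]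
  have h1 : ‖truncate (· ∈ F) ψ‖ ≤ ‖truncate (· ∈ F) χ‖ + ‖ψ - χ‖ := by
    have h2 := norm_truncate_mem_le F (ψ - χ)
    rw [← truncate_sub] at h2
    have h3 := norm_sub_norm_le (truncate (· ∈ F) ψ) (truncate (· ∈ F) χ)
    linarith
  have := norm_nonneg (truncate (· ∈ F) ψ)
  nlinarith [sq_nonneg (‖truncate (· ∈ F) χ‖ - ‖ψ - χ‖)]

lemma abs_weight_sub_weight_le (F : Finset ι) {ψ χ : Ket ι} (hψ : ‖ψ‖ ≤ 1) (hχ : ‖χ‖ ≤ 1) :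
    |weight F ψ - weight F χ| ≤ 2 * ‖ψ - χ‖ := by
  rw [weight_eq_norm_truncate_sq, weight_eq_norm_truncate_sq, sq_sub_sq, abs_mul]
  have h2 := norm_truncate_mem_le F (ψ - χ)
  rw [← truncate_sub] at h2
  have h3 := abs_norm_sub_norm_le (truncate (· ∈ F) ψ) (truncate (· ∈ F) χ)
  refine mul_le_mul ?_ (h3.trans h2) (abs_nonneg _) (by norm_num)
  rw [abs_of_nonneg (by positivity)]
  linarith [norm_truncate_mem_le F ψ, norm_truncate_mem_le F χ]

end Weight

/-! ### Runs of an algorithm as isometries -/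

lemma norm_tensorKet {ι κ : Type} [Fintype ι] [Fintype κ] (φ : Ket ι) (ψ : Ket κ) :
    ‖tensorKet φ ψ‖ = ‖φ‖ * ‖ψ‖ := by
  have h : ‖tensorKet φ ψ‖ ^ 2 = (‖φ‖ * ‖ψ‖) ^ 2 := by
    rw [mul_pow, EuclideanSpace.norm_sq_eq, EuclideanSpace.norm_sq_eq, EuclideanSpace.norm_sq_eq,
      Finset.sum_mul_sum, Fintype.sum_prod_type]
    simp [tensorKet, mul_pow]
  exact (sq_eq_sq₀ (norm_nonneg _) (by positivity)).1 h

namespace QueryAlgorithm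

variable {n k q : ℕ} {α : Type}

lemma state_zero (A : QueryAlgorithm n k q α) (f : BitString n → Bool)
    (φ : Ket (Fin k → BitString n)) : A.state f φ 0 = A.U 0 (tensorKet φ A.init) := rfl

lemma state_succ (A : QueryAlgorithm n k q α) (f : BitString n → Bool)
    (φ : Ket (Fin k → BitString n)) (i : Fin q) :
    A.state f φ i.succ = A.U i.succ (oracleGate f (A.state f φ i.castSucc)) := by
  rw [state, Fin.induction_succ]

lemma norm_state (A : QueryAlgorithm n k q α) (f : BitString n → Bool)
    (φ : Ket (Fin k → BitString n)) (i : Fin (q + 1)) : ‖A.state f φ i‖ = ‖φ‖ := by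
  induction i using Fin.induction with
  | zero => rw [state_zero, LinearIsometryEquiv.norm_map, norm_tensorKet, A.norm_init, mul_one]
  | succ i ih => rw [state_succ, LinearIsometryEquiv.norm_map, LinearIsometryEquiv.norm_map, ih]

lemma state_add (A : QueryAlgorithm n k q α) (f : BitString n → Bool)
    (φ ψ : Ket (Fin k → BitString n)) (i : Fin (q + 1)) :
    A.state f (φ + ψ) i = A.state f φ i + A.state f ψ i := by
  induction i using Fin.induction with
  | zero =>
    rw [state_zero, state_zero, state_zero, ← map_add]
    congr 1; ext b; simp [tensorKet, add_mul]
  | succ i ih => rw [state_succ, state_succ, state_succ, ih, map_add, map_add]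

lemma state_smul (A : QueryAlgorithm n k q α) (f : BitString n → Bool)
    (c : ℂ) (φ : Ket (Fin k → BitString n)) (i : Fin (q + 1)) :
    A.state f (c • φ) i = c • A.state f φ i := by
  induction i using Fin.induction with
  | zero =>
    rw [state_zero, state_zero, ← map_smul]
    congr 1; ext b; simp [tensorKet, mul_assoc]
  | succ i ih => rw [state_succ, state_succ, ih, map_smul, map_smul]

/-- The final state of the algorithm as a linear isometric function of the input state. -/
def run (A : QueryAlgorithm n k q α) (f : BitString n → Bool) :
    Ket (Fin k → BitString n) →ₗᵢ[ℂ] Ket (RegisterBasis n k A.w) where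
  toFun φ := A.state f φ (Fin.last q)
  map_add' φ ψ := A.state_add f φ ψ _
  map_smul' c φ := A.state_smul f c φ _
  norm_map' φ := A.norm_state f φ _

open Classical in
lemma prob_eq_weight (A : QueryAlgorithm n k q α) (f : BitString n → Bool)
    (φ : Ket (Fin k → BitString n)) (E : Set α) :
    A.prob f φ E = weight {b | A.out b ∈ E} (A.run f φ) := rfl

lemma prob_nonneg (A : QueryAlgorithm n k q α) (f : BitString n → Bool)
    (φ : Ket (Fin k → BitString n)) (E : Set α) : 0 ≤ A.prob f φ E := by
  rw [prob_eq_weight]; exact weight_nonneg _ _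

lemma prob_le_one (A : QueryAlgorithm n k q α) (f : BitString n → Bool)
    {φ : Ket (Fin k → BitString n)} (hφ : ‖φ‖ = 1) (E : Set α) : A.prob f φ E ≤ 1 := by
  rw [prob_eq_weight]
  refine (weight_le_norm_sq _ _).trans_eq ?_
  rw [LinearIsometry.norm_map, hφ, one_pow]

end QueryAlgorithm

/-! ### Changing the oracle on a set of rarely queried points -/

/-- The part of a register state in which the query register holds an element of `D`. -/
def queryPart {n k w : ℕ} (D : Finset (BitString n)) (ψ : Ket (RegisterBasis n k w)) :
    Ket (RegisterBasis n k w) := truncate (fun b => b.2.1 ∈ D) ψ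

lemma norm_queryPart_sq {n k w : ℕ} (D : Finset (BitString n)) (ψ : Ket (RegisterBasis n k w)) :
    ‖queryPart D ψ‖ ^ 2 = ∑ x ∈ D, ∑ b with b.2.1 = x, ‖ψ b‖ ^ 2 := by
  classical
  have h := weight_eq_norm_truncate_sq
    (Finset.univ.filter fun b : RegisterBasis n k w => b.2.1 ∈ D) ψ
  simp only [Finset.mem_filter, Finset.mem_univ, true_and] at h
  rw [queryPart, ← h, weight,
    ← Finset.sum_fiberwise_of_maps_to (t := D) (g := fun b : RegisterBasis n k w => b.2.1)
      (fun b hb => (Finset.mem_filter.1 hb).2)]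
  refine Finset.sum_congr rfl fun x hx => Finset.sum_congr ?_ fun _ _ => rfl
  ext b; simp only [Finset.mem_filter, Finset.mem_univ, true_and]
  exact ⟨fun h => h.2, fun h => ⟨h ▸ hx, h⟩⟩

lemma oracleGate_apply {n k w : ℕ} (f : BitString n → Bool) (ψ : Ket (RegisterBasis n k w))
    (b : RegisterBasis n k w) :
    oracleGate f ψ b = ψ (b.1, (b.2.1, (xor b.2.2.1 (f b.2.1), b.2.2.2))) := by
  simp only [oracleGate, LinearIsometryEquiv.piLpCongrLeft_apply]
  rfl

lemma norm_oracleGate_sub_le {n k w : ℕ} {f g : BitString n → Bool} {D : Finset (BitString n)}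
    (hfg : ∀ x ∉ D, f x = g x) (ψ : Ket (RegisterBasis n k w)) :
    ‖oracleGate f ψ - oracleGate g ψ‖ ≤ 2 * ‖queryPart D ψ‖ := by
  have h : oracleGate f ψ - oracleGate g ψ =
      oracleGate f (queryPart D ψ) - oracleGate g (queryPart D ψ) := by
    ext b
    simp only [PiLp.sub_apply, oracleGate_apply, queryPart, truncate]
    split_ifs with hb
    · rfl
    · rw [hfg _ hb]; simp
  rw [h]
  refine (norm_sub_le _ _).trans_eq ?_
  rw [LinearIsometryEquiv.norm_map, LinearIsometryEquiv.norm_map]; ring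

namespace QueryAlgorithm

variable {n k q : ℕ} {α : Type}

/-- The hybrid argument: each query contributes the amplitude that the run with oracle `f` puts on
the points where the two oracles differ. -/
lemma norm_state_sub_le (A : QueryAlgorithm n k q α) {f g : BitString n → Bool}
    {D : Finset (BitString n)} (hfg : ∀ x ∉ D, f x = g x) (φ : Ket (Fin k → BitString n)) :
    ‖A.run f φ - A.run g φ‖ ≤ 2 * ∑ j : Fin q, ‖queryPart D (A.state f φ j.castSucc)‖ := by
  have key : ∀ i : Fin (q + 1), ‖A.state f φ i - A.state g φ i‖ ≤
      2 * ∑ j : Fin q with j.castSucc < i, ‖queryPart D (A.state f φ j.castSucc)‖ := by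
    intro i
    induction i using Fin.induction with
    | zero => simp [state_zero]
    | succ i ih =>
      have hset : (Finset.univ.filter fun j : Fin q => j.castSucc < i.succ) =
          insert i (Finset.univ.filter fun j : Fin q => j.castSucc < i.castSucc) := by
        ext j
        simp only [Finset.mem_filter, Finset.mem_univ, true_and, Finset.mem_insert, Fin.lt_def,
          Fin.ext_iff, Fin.val_castSucc, Fin.val_succ]
        omega
      rw [hset, Finset.sum_insert (by simp), state_succ, state_succ, ← map_sub,
        LinearIsometryEquiv.norm_map]
      have h1 : oracleGate f (A.state f φ i.castSucc) - oracleGate g (A.state g φ i.castSucc) =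
          (oracleGate f (A.state f φ i.castSucc) - oracleGate g (A.state f φ i.castSucc)) +
            oracleGate g (A.state f φ i.castSucc - A.state g φ i.castSucc) := by
        rw [map_sub]; abel
      rw [h1]
      refine (norm_add_le _ _).trans ?_
      rw [LinearIsometryEquiv.norm_map]
      linarith [norm_oracleGate_sub_le hfg (A.state f φ i.castSucc)]
  have h := key (Fin.last q)
  simp only [Fin.castSucc_lt_last, Finset.filter_true] at h
  exact h

end QueryAlgorithm

/-! ### Averages over subsets of fixed size -/

section Averages

variable {α : Type} [DecidableEq α]

/-- Choosing `S` and then enlarging it at random is the same as choosing the larger set and then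
a random subset of it. -/
lemma expect_powersetCard_extend (U : Finset α) {s t : ℕ} (hst : s ≤ t)
    (f : Finset α → Finset α → ℝ) :
    Finset.expect (Finset.powersetCard s U) (fun S =>
      Finset.expect (Finset.powersetCard (t - s) (U \ S)) fun R => f S (S ∪ R)) =
    Finset.expect (Finset.powersetCard t U) (fun T =>
      Finset.expect (Finset.powersetCard s T) fun S => f S T) := by
  have hsum : ∑ S ∈ Finset.powersetCard s U, ∑ R ∈ Finset.powersetCard (t - s) (U \ S),
      f S (S ∪ R) = ∑ T ∈ Finset.powersetCard t U, ∑ S ∈ Finset.powersetCard s T, f S T := by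
    rw [Finset.sum_sigma', Finset.sum_sigma']
    refine Finset.sum_bij' (fun p _ => ⟨p.1 ∪ p.2, p.1⟩) (fun p _ => ⟨p.2, p.1 \ p.2⟩)
      ?_ ?_ ?_ ?_ ?_
    · rintro ⟨S, R⟩ h
      simp only [Finset.mem_sigma, Finset.mem_powersetCard] at h ⊢
      obtain ⟨⟨hS, hSc⟩, hR, hRc⟩ := h
      have hd : Disjoint S R := (Finset.disjoint_of_subset_left hR Finset.sdiff_disjoint).symm
      refine ⟨⟨Finset.union_subset hS (hR.trans Finset.sdiff_subset), ?_⟩,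
        Finset.subset_union_left, hSc⟩
      rw [Finset.card_union_of_disjoint hd]; omega
    · rintro ⟨T, S⟩ h
      simp only [Finset.mem_sigma, Finset.mem_powersetCard] at h ⊢
      obtain ⟨⟨hT, hTc⟩, hS, hSc⟩ := h
      refine ⟨⟨hS.trans hT, hSc⟩, Finset.sdiff_subset_sdiff hT subset_rfl, ?_⟩
      rw [Finset.card_sdiff_of_subset hS]; omega
    · rintro ⟨S, R⟩ h
      simp only [Finset.mem_sigma, Finset.mem_powersetCard] at h
      have hd : Disjoint S R := (Finset.disjoint_of_subset_left h.2.1 Finset.sdiff_disjoint).symm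
      simp [Finset.union_sdiff_cancel_left hd]
    · rintro ⟨T, S⟩ h
      simp only [Finset.mem_sigma, Finset.mem_powersetCard] at h
      simp [Finset.union_sdiff_of_subset h.2.1]
    · rintro ⟨S, R⟩ h; rfl
  have h1 : ∀ S ∈ Finset.powersetCard s U,
      Finset.expect (Finset.powersetCard (t - s) (U \ S)) (fun R => f S (S ∪ R)) =
      (∑ R ∈ Finset.powersetCard (t - s) (U \ S), f S (S ∪ R)) /
        ((U.card - s).choose (t - s) : ℝ) := by
    intro S hS
    rw [Finset.mem_powersetCard] at hS
    rw [Finset.expect_eq_sum_div_card, Finset.card_powersetCard, Finset.card_sdiff_of_subset hS.1,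
      hS.2]
  have h2 : ∀ T ∈ Finset.powersetCard t U,
      Finset.expect (Finset.powersetCard s T) (fun S => f S T) =
      (∑ S ∈ Finset.powersetCard s T, f S T) / (t.choose s : ℝ) := by
    intro T hT
    rw [Finset.mem_powersetCard] at hT
    rw [Finset.expect_eq_sum_div_card, Finset.card_powersetCard, hT.2]
  rw [Finset.expect_congr rfl h1, Finset.expect_congr rfl h2, Finset.expect_eq_sum_div_card,
    Finset.expect_eq_sum_div_card, ← Finset.sum_div, ← Finset.sum_div, hsum,
    Finset.card_powersetCard, Finset.card_powersetCard, div_div, div_div]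
  congr 1
  have := Nat.choose_mul (n := U.card) hst
  rw [mul_comm, mul_comm (t.choose s : ℝ)]
  exact_mod_cast this.symm

lemma expect_powersetCard_sum (W : Finset α) {r : ℕ} (hr : r ≤ W.card) (h : α → ℝ) :
    Finset.expect (Finset.powersetCard r W) (fun R => ∑ x ∈ R, h x) =
      (r / W.card : ℝ) * ∑ x ∈ W, h x := by
  rcases Nat.eq_zero_or_pos r with rfl | hr0
  · simp
  have hW : 0 < W.card := hr0.trans_le hr
  have h1 : ∑ R ∈ Finset.powersetCard r W, ∑ x ∈ R, h x =
      ∑ x ∈ W, ((W.card - 1).choose (r - 1) : ℝ) * h x := by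
    rw [Finset.sum_comm' (s' := fun x => (Finset.powersetCard r W).filter ({x} ⊆ ·)) (t' := W)]
    · refine Finset.sum_congr rfl fun x hx => ?_
      rw [Finset.sum_const, Finset.card_filter_powersetCard_subset _ _ _ (by simpa using hx)
        (by rw [Finset.card_singleton]; exact hr0)]
      simp
    · intro R x
      simp only [Finset.mem_filter, Finset.mem_powersetCard, Finset.singleton_subset_iff]
      constructor
      · rintro ⟨⟨h1, h2⟩, h3⟩; exact ⟨⟨⟨h1, h2⟩, h3⟩, h1 h3⟩
      · rintro ⟨⟨⟨h1, h2⟩, h3⟩, _⟩; exact ⟨⟨h1, h2⟩, h3⟩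
  rw [Finset.expect_eq_sum_div_card, h1, ← Finset.mul_sum, Finset.card_powersetCard]
  have h2 : W.card * (W.card - 1).choose (r - 1) = W.card.choose r * r := by
    obtain ⟨w, hw⟩ := Nat.exists_eq_succ_of_ne_zero hW.ne'
    obtain ⟨r', rfl⟩ := Nat.exists_eq_succ_of_ne_zero hr0.ne'
    rw [hw]
    simpa using Nat.add_one_mul_choose_eq w r'
  have h3 : (W.card : ℝ) * (W.card - 1).choose (r - 1) = W.card.choose r * r := by
    exact_mod_cast h2
  have h4 : (0 : ℝ) < W.card.choose r := by exact_mod_cast Nat.choose_pos hr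
  have h5 : (0 : ℝ) < W.card := by exact_mod_cast hW
  field_simp
  linear_combination (∑ x ∈ W, h x) * h3

lemma expect_le_sqrt_expect_sq {ι : Type} (s : Finset ι) (h : ι → ℝ) :
    Finset.expect s h ≤ √(Finset.expect s fun i => h i ^ 2) := by
  apply Real.le_sqrt_of_sq_le
  rw [Finset.expect_eq_sum_div_card, Finset.expect_eq_sum_div_card]
  rcases s.eq_empty_or_nonempty with rfl | hs
  · simp
  have hc : (0 : ℝ) < s.card := by exact_mod_cast hs.card_pos
  rw [div_pow, div_le_div_iff₀ (by positivity) hc]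
  nlinarith [sq_sum_le_card_mul_sum_sq (s := s) (f := h)]

lemma abs_expect_le {ι : Type} (s : Finset ι) (h : ι → ℝ) :
    |Finset.expect s h| ≤ Finset.expect s fun i => |h i| := by
  rw [Finset.expect_eq_sum_div_card, Finset.expect_eq_sum_div_card, abs_div, Nat.abs_cast]
  gcongr
  exact Finset.abs_sum_le_sum_abs _ _

lemma expect_le_const {ι : Type} {s : Finset ι} {h : ι → ℝ} {c : ℝ} (hc : 0 ≤ c)
    (hh : ∀ i ∈ s, h i ≤ c) : Finset.expect s h ≤ c := by
  rcases s.eq_empty_or_nonempty with rfl | hs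
  · simpa using hc
  · exact (Finset.expect_le_expect hh).trans_eq (Finset.expect_const hs c)

end Averages

/-! ### Oracles for a random superset -/

namespace QueryAlgorithm

variable {n k q : ℕ} {α : Type}

/-- Enlarging the set behind the membership oracle by a random set `R` of fresh points is hardly
noticed, because the run with the original oracle does not depend on `R`. -/
lemma abs_prob_sub_expect_prob_le (A : QueryAlgorithm n k q α) {S : Finset (BitString n)} {s t : ℕ}
    (hS : S.card = s) (hst : s ≤ t) (ht : t ≤ 2 ^ n) {φ : Ket (Fin k → BitString n)}
    (hφ : ‖φ‖ = 1) (E : Set α) :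
    |A.prob (membership S) φ E - Finset.expect (Finset.powersetCard (t - s) (Finset.univ \ S))
      (fun R => A.prob (membership (S ∪ R)) φ E)| ≤
      4 * q * √(((t : ℝ) - s) / ((2 : ℝ) ^ n - s)) := by
  classical
  have hcard : (Finset.univ \ S).card = 2 ^ n - s := by
    rw [Finset.card_sdiff_of_subset (Finset.subset_univ _), hS, Finset.card_univ]; simp
  have hcardR : ((Finset.univ \ S).card : ℝ) = (2 : ℝ) ^ n - s := by
    rw [hcard, Nat.cast_sub (hst.trans ht)]; simp
  have hr : t - s ≤ (Finset.univ \ S).card := by omega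
  have hne : (Finset.powersetCard (t - s) (Finset.univ \ S)).Nonempty :=
    Finset.powersetCard_nonempty.2 hr
  rw [← Finset.expect_const hne (A.prob (membership S) φ E), ← Finset.expect_sub_distrib]
  refine (abs_expect_le _ _).trans ?_
  have h1 : ∀ R ∈ Finset.powersetCard (t - s) (Finset.univ \ S),
      |A.prob (membership S) φ E - A.prob (membership (S ∪ R)) φ E| ≤
        ∑ j : Fin q, 4 * ‖queryPart R (A.state (membership S) φ j.castSucc)‖ := by
    intro R hR
    rw [prob_eq_weight, prob_eq_weight]
    refine (abs_weight_sub_weight_le _ (by simp [hφ]) (by simp [hφ])).trans ?_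
    have := A.norm_state_sub_le (f := membership S) (g := membership (S ∪ R)) (D := R)
      (fun x hx => by simp [membership, hx]) φ
    rw [← Finset.mul_sum]
    linarith
  refine (Finset.expect_le_expect h1).trans ?_
  rw [Finset.expect_sum_comm]
  have h2 : ∀ j : Fin q, Finset.expect (Finset.powersetCard (t - s) (Finset.univ \ S))
      (fun R => 4 * ‖queryPart R (A.state (membership S) φ j.castSucc)‖) ≤
      4 * √(((t : ℝ) - s) / ((2 : ℝ) ^ n - s)) := by
    intro j
    rw [← Finset.mul_expect]
    refine mul_le_mul_of_nonneg_left ((expect_le_sqrt_expect_sq _ _).trans ?_) (by norm_num)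
    apply Real.sqrt_le_sqrt
    simp only [norm_queryPart_sq]
    rw [expect_powersetCard_sum _ hr, hcardR, Nat.cast_sub hst]
    have h0 : (0 : ℝ) ≤ ((t : ℝ) - s) / ((2 : ℝ) ^ n - s) := by
      rw [← hcardR, ← Nat.cast_sub hst]; positivity
    refine mul_le_of_le_one_right h0 ?_
    rw [← norm_queryPart_sq, queryPart, ← one_pow 2, ← hφ,
      ← A.norm_state (membership S) φ j.castSucc]
    have := weight_le_norm_sq (Finset.univ.filter fun b : RegisterBasis n k A.w =>
      b.2.1 ∈ Finset.univ \ S) (A.state (membership S) φ j.castSucc)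
    rw [weight_eq_norm_truncate_sq] at this
    simpa only [Finset.mem_filter, Finset.mem_univ, true_and] using this
  refine (Finset.sum_le_sum fun j _ => h2 j).trans_eq ?_
  rw [Finset.sum_const, Finset.card_univ, Fintype.card_fin, nsmul_eq_mul]; ring

end QueryAlgorithm

/-! ### Copies of a subset state as superpositions of the states `|σ_X⟩` -/

section SubsetStates

variable {n k : ℕ}

lemma card_injective_image_eq {α : Type} [Fintype α] [DecidableEq α] {X : Finset α}
    (hX : X.card = k) :
    (Finset.univ.filter fun a : Fin k → α =>
      Function.Injective a ∧ Finset.univ.image a = X).card = k.factorial := by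
  classical
  have h1 : Fintype.card (Fin k ≃ X) = k.factorial := by
    rw [Fintype.card_equiv (X.equivFinOfCardEq hX).symm, Fintype.card_fin]
  rw [← h1, ← Finset.card_univ]
  symm
  refine Finset.card_bij (fun e _ i => (e i : α)) ?_ ?_ ?_
  · intro e _
    simp only [Finset.mem_filter, Finset.mem_univ, true_and]
    refine ⟨Subtype.val_injective.comp e.injective, ?_⟩
    ext y
    simp only [Finset.mem_image, Finset.mem_univ, true_and]
    exact ⟨fun ⟨i, hi⟩ => hi ▸ (e i).2, fun hy => ⟨e.symm ⟨y, hy⟩, by simp⟩⟩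
  · intro e _ e' _ h
    ext i
    exact congrFun h i
  · intro a ha
    simp only [Finset.mem_filter, Finset.mem_univ, true_and] at ha
    obtain ⟨ha, him⟩ := ha
    have hmem : ∀ i, a i ∈ X := fun i => him ▸ Finset.mem_image_of_mem _ (Finset.mem_univ i)
    refine ⟨Equiv.ofBijective (fun i => ⟨a i, hmem i⟩) ⟨fun i j hij => ha (by simpa using hij), ?_⟩,
      Finset.mem_univ _, rfl⟩
    rintro ⟨y, hy⟩
    rw [← him] at hy
    obtain ⟨i, -, hi⟩ := Finset.mem_image.1 hy
    exact ⟨i, by simp [hi]⟩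

lemma sum_sigmaKet_apply (𝒳 : Finset (Finset (BitString n))) (a : Fin k → BitString n) :
    (∑ X ∈ 𝒳, sigmaKet k X) a = open Classical in
      if Function.Injective a ∧ Finset.univ.image a ∈ 𝒳 then
        (((√(k.factorial : ℝ))⁻¹ : ℝ) : ℂ) else 0 := by
  classical
  simp only [WithLp.ofLp_sum, Finset.sum_apply, sigmaKet]
  by_cases ha : Function.Injective a
  · simp only [ha, true_and, Finset.sum_ite_eq]
  · simp [ha]

/-- The states `|σ_X⟩` are orthonormal: a sum of `m` of them has squared norm `m`. -/
lemma norm_sum_sigmaKet_sq {𝒳 : Finset (Finset (BitString n))} (h𝒳 : ∀ X ∈ 𝒳, X.card = k) :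
    ‖∑ X ∈ 𝒳, sigmaKet k X‖ ^ 2 = 𝒳.card := by
  classical
  have hk : (0 : ℝ) < k.factorial := by exact_mod_cast k.factorial_pos
  have h1 : ∀ a : Fin k → BitString n, ‖(∑ X ∈ 𝒳, sigmaKet k X) a‖ ^ 2 =
      ∑ X ∈ 𝒳, if Function.Injective a ∧ Finset.univ.image a = X then
        ((k.factorial : ℝ))⁻¹ else 0 := by
    intro a
    rw [sum_sigmaKet_apply]
    by_cases ha : Function.Injective a
    · simp only [ha, true_and, Finset.sum_ite_eq]
      split_ifs
      · rw [Complex.norm_real, Real.norm_eq_abs, sq_abs, inv_pow, Real.sq_sqrt hk.le]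
      · simp
    · simp [ha]
  rw [EuclideanSpace.norm_sq_eq, Finset.sum_congr rfl fun a _ => h1 a, Finset.sum_comm]
  rw [Finset.sum_congr rfl (g := fun _ => (1 : ℝ))]
  · simp
  · intro X hX
    rw [← Finset.sum_filter, Finset.sum_const, card_injective_image_eq (h𝒳 X hX), nsmul_eq_mul,
      mul_inv_cancel₀ hk.ne']

lemma norm_sigmaKet {X : Finset (BitString n)} (hX : X.card = k) : ‖sigmaKet k X‖ = 1 := by
  have h := norm_sum_sigmaKet_sq (k := k) (𝒳 := {X}) (by simpa using hX)
  rw [Finset.sum_singleton, Finset.card_singleton, Nat.cast_one] at h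
  exact (pow_eq_one_iff_of_nonneg (norm_nonneg _) two_ne_zero).1 h

lemma norm_subsetKet {S : Finset (BitString n)} (hS : 0 < S.card) : ‖subsetKet S‖ = 1 := by
  have hs : (0 : ℝ) < S.card := by exact_mod_cast hS
  have h : ‖subsetKet S‖ ^ 2 = 1 := by
    have h1 : ∀ x, ‖subsetKet S x‖ ^ 2 = if x ∈ S then (S.card : ℝ)⁻¹ else 0 := by
      intro x
      simp only [subsetKet]
      split_ifs
      · rw [Complex.norm_real, Real.norm_eq_abs, sq_abs, inv_pow, Real.sq_sqrt hs.le]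
      · simp
    rw [EuclideanSpace.norm_sq_eq, Finset.sum_congr rfl fun x _ => h1 x]
    simp [hs.ne']
  exact (pow_eq_one_iff_of_nonneg (norm_nonneg _) two_ne_zero).1 h

lemma norm_tensorPower {ι : Type} [Fintype ι] (ψ : Ket ι) (k : ℕ) :
    ‖tensorPower ψ k‖ = ‖ψ‖ ^ k := by
  have h : ‖tensorPower ψ k‖ ^ 2 = (‖ψ‖ ^ k) ^ 2 := by
    classical
    rw [← pow_mul, mul_comm k, pow_mul, EuclideanSpace.norm_sq_eq, EuclideanSpace.norm_sq_eq,
      ← Fin.prod_const, Finset.prod_univ_sum, Fintype.piFinset_univ]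
    simp [tensorPower, Finset.prod_pow]
  exact (sq_eq_sq₀ (norm_nonneg _) (by positivity)).1 h

/-- The superposition `√(k! / s^k) ∑_{X ⊆ S, |X| = k} |σ_X⟩`. For `|S| = s` it is the part of
`|S⟩^{⊗ k}` supported on tuples of distinct strings; the normalization stays a separate
parameter, so that it can be kept while `S` grows. -/
def distinctKet (k s : ℕ) (S : Finset (BitString n)) : Ket (Fin k → BitString n) :=
  ((√((k.factorial : ℝ) / (s : ℝ) ^ k) : ℝ) : ℂ) • ∑ X ∈ Finset.powersetCard k S, sigmaKet k X

lemma truncate_tensorPower_subsetKet {S : Finset (BitString n)} {s : ℕ} (hS : S.card = s) :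
    truncate Function.Injective (tensorPower (subsetKet S) k) = distinctKet k s S := by
  classical
  ext a
  have hk : (0 : ℝ) < k.factorial := by exact_mod_cast k.factorial_pos
  simp only [truncate, tensorPower, subsetKet, distinctKet, PiLp.smul_apply, smul_eq_mul]
  rw [sum_sigmaKet_apply]
  by_cases ha : Function.Injective a
  · have h1 : Finset.univ.image a ∈ Finset.powersetCard k S ↔ ∀ i, a i ∈ S := by
      rw [Finset.mem_powersetCard, Finset.card_image_of_injective _ ha, Finset.card_univ,
        Fintype.card_fin, Finset.image_subset_iff]
      simp
    simp only [ha, true_and, h1, if_true]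
    split_ifs with h
    · rw [Finset.prod_congr rfl (g := fun _ => (((√(S.card : ℝ))⁻¹ : ℝ) : ℂ))
        fun i _ => if_pos (h i), Finset.prod_const, Finset.card_univ, Fintype.card_fin, hS,
        ← Complex.ofReal_pow, ← Complex.ofReal_mul]
      congr 1
      rw [Real.sqrt_div hk.le, Real.sqrt_eq_rpow ((s : ℝ) ^ k), Real.sqrt_eq_rpow (s : ℝ), inv_pow,
        ← Real.rpow_natCast_mul (Nat.cast_nonneg s), ← Real.rpow_mul_natCast (Nat.cast_nonneg s),
        mul_comm (k : ℝ)]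
      have := Real.sqrt_pos.2 hk
      field_simp
    · push Not at h
      obtain ⟨i, hi⟩ := h
      rw [Finset.prod_eq_zero (Finset.mem_univ i) (if_neg hi), mul_zero]
  · simp [ha]

lemma norm_distinctKet_sub_sq {s : ℕ} {S S' : Finset (BitString n)} (h : S ⊆ S') :
    ‖distinctKet k s S' - distinctKet k s S‖ ^ 2 =
      ((S'.card.descFactorial k : ℝ) - S.card.descFactorial k) / (s : ℝ) ^ k := by
  have hsub := Finset.powersetCard_mono (n := k) h
  have hk : (0 : ℝ) < k.factorial := by exact_mod_cast k.factorial_pos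
  rw [distinctKet, distinctKet, ← smul_sub,
    ← Finset.sum_sdiff hsub, add_sub_cancel_right, norm_smul, mul_pow, norm_sum_sigmaKet_sq,
    Complex.norm_real, Real.norm_eq_abs, sq_abs, Real.sq_sqrt (by positivity),
    Finset.card_sdiff_of_subset hsub, Nat.cast_sub (Finset.card_le_card hsub),
    Finset.card_powersetCard, Finset.card_powersetCard, Nat.descFactorial_eq_factorial_mul_choose,
    Nat.descFactorial_eq_factorial_mul_choose]
  · push_cast; ring
  · intro X hX
    exact (Finset.mem_powersetCard.1 (Finset.mem_sdiff.1 hX).1).2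

lemma norm_distinctKet_sq {s : ℕ} {S : Finset (BitString n)} (hk : 1 ≤ k) :
    ‖distinctKet k s S‖ ^ 2 = (S.card.descFactorial k : ℝ) / (s : ℝ) ^ k := by
  have h := norm_distinctKet_sub_sq (k := k) (s := s) (Finset.empty_subset S)
  have h0 : distinctKet k s (∅ : Finset (BitString n)) = 0 := by
    rw [distinctKet, Finset.powersetCard_eq_empty.2 (by rw [Finset.card_empty]; exact hk)]; simp
  rw [h0, sub_zero, Finset.card_empty] at h
  rw [h, Nat.descFactorial_of_lt hk]
  simp

/-- The probability that `k` independent samples from `s` elements are distinct. -/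
lemma one_sub_le_descFactorial_div {s : ℕ} (hks : k ≤ s) (hs : 0 < s) :
    1 - (k : ℝ) ^ 2 / s ≤ (s.descFactorial k : ℝ) / (s : ℝ) ^ k := by
  have hs' : (0 : ℝ) < s := by exact_mod_cast hs
  have hks' : (k : ℝ) ≤ s := by exact_mod_cast hks
  have h1 : ((s : ℝ) - k) ^ k ≤ s.descFactorial k := by
    have h2 : ((s - k : ℕ) : ℝ) ^ k ≤ s.descFactorial k := by
      have h3 : (s - k) ^ k ≤ s.descFactorial k :=
        (Nat.pow_le_pow_left (by omega) k).trans (Nat.pow_sub_le_descFactorial s k)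
      exact_mod_cast h3
    rwa [Nat.cast_sub hks] at h2
  have h4 : 1 + (k : ℝ) * (-(k / s)) ≤ (1 + -((k : ℝ) / s)) ^ k := by
    apply one_add_mul_le_pow
    have : (k : ℝ) / s ≤ 1 := (div_le_one hs').2 hks'
    linarith
  have h5 : (1 + -((k : ℝ) / s)) = ((s : ℝ) - k) / s := by field_simp; ring
  rw [h5, div_pow] at h4
  refine le_trans ?_ (h4.trans (div_le_div_of_nonneg_right h1 (by positivity)))
  apply le_of_eq; ring

/-- The copies of `|S⟩` collide with probability at most `k² / s`. -/
lemma norm_tensorPower_sub_distinctKet_sq_le {S : Finset (BitString n)} {s : ℕ} (hS : S.card = s)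
    (hk : 1 ≤ k) (hks : k ≤ s) :
    ‖tensorPower (subsetKet S) k - distinctKet k s S‖ ^ 2 ≤ (k : ℝ) ^ 2 / s := by
  classical
  have h1 : tensorPower (subsetKet S) k - distinctKet k s S =
      truncate (· ∈ (Finset.univ.filter Function.Injective)ᶜ) (tensorPower (subsetKet S) k) := by
    rw [← truncate_tensorPower_subsetKet hS]
    ext a
    simp only [truncate, PiLp.sub_apply, Finset.mem_compl, Finset.mem_filter, Finset.mem_univ,
      true_and]
    split_ifs <;> simp_all
  have h2 : truncate (· ∈ (Finset.univ.filter Function.Injective))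
      (tensorPower (subsetKet S) k) = distinctKet k s S := by
    simp only [Finset.mem_filter, Finset.mem_univ, true_and]
    exact truncate_tensorPower_subsetKet hS
  rw [h1, ← weight_eq_norm_truncate_sq, weight_compl, weight_eq_norm_truncate_sq, h2,
    norm_distinctKet_sq hk, norm_tensorPower, norm_subsetKet (by omega), one_pow, one_pow, hS]
  linarith [one_sub_le_descFactorial_div hks (by omega)]

end SubsetStates

/-! ### A random subset state hides all but a random `k`-subset -/

section Kernels

variable {α : Type} [DecidableEq α]

/-- A weighted sum of squared norms of real combinations of the `c X`, written through its
Gram kernel. -/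
lemma sum_mul_norm_sum_sq {ι κ : Type} (I : Finset ι) (𝒳 : Finset κ) (w : ι → ℝ)
    (a : ι → κ → ℝ) (c : κ → ℂ) :
    ∑ i ∈ I, w i * ‖∑ X ∈ 𝒳, (a i X : ℂ) * c X‖ ^ 2 =
      ∑ X ∈ 𝒳, ∑ X' ∈ 𝒳, (∑ i ∈ I, w i * (a i X * a i X')) *
        (c X * (starRingEnd ℂ) (c X')).re := by
  have h1 : ∀ i, ‖∑ X ∈ 𝒳, (a i X : ℂ) * c X‖ ^ 2 =
      ∑ X ∈ 𝒳, ∑ X' ∈ 𝒳, (a i X * a i X') * (c X * (starRingEnd ℂ) (c X')).re := by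
    intro i
    apply Complex.ofReal_injective
    rw [Complex.ofReal_pow, ← Complex.mul_conj', map_sum, Finset.sum_mul_sum]
    have h2 : (∑ X ∈ 𝒳, ∑ X' ∈ 𝒳, (a i X : ℂ) * c X * (starRingEnd ℂ) ((a i X' : ℂ) * c X')).im
        = 0 := by
      rw [← Finset.sum_mul_sum, ← map_sum, Complex.mul_conj, Complex.ofReal_im]
    apply Complex.ext
    · simp only [Complex.re_sum, Complex.ofReal_re]
      refine Finset.sum_congr rfl fun X _ => Finset.sum_congr rfl fun X' _ => ?_
      rw [map_mul, Complex.conj_ofReal, ← Complex.re_ofReal_mul, Complex.ofReal_mul]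
      congr 1; ring
    · rw [h2, Complex.ofReal_im]
  simp only [h1, Finset.mul_sum, Finset.sum_mul]
  rw [Finset.sum_comm]
  refine Finset.sum_congr rfl fun X _ => ?_
  rw [Finset.sum_comm]
  exact Finset.sum_congr rfl fun X' _ => Finset.sum_congr rfl fun i _ => by ring

/-- Vandermonde's identity, as a sum over the subsets of `I`. -/
lemma sum_powerset_choose_add (m r : ℕ) (I : Finset α) :
    ∑ Y ∈ I.powerset, m.choose (r + Y.card) = (m + I.card).choose (r + I.card) := by
  induction I using Finset.induction_on generalizing r with
  | empty => simp
  | insert x I hx ih =>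
    rw [Finset.sum_powerset_insert hx, ih, Finset.card_insert_of_notMem hx]
    have h1 : ∑ Y ∈ I.powerset, m.choose (r + (insert x Y).card) =
        ∑ Y ∈ I.powerset, m.choose (r + 1 + Y.card) := by
      refine Finset.sum_congr rfl fun Y hY => ?_
      rw [Finset.card_insert_of_notMem fun h => hx (Finset.mem_powerset.1 hY h)]
      congr 1; omega
    rw [h1, ih, show r + (I.card + 1) = (r + I.card) + 1 by omega,
      show r + 1 + I.card = (r + I.card) + 1 by omega, ← add_assoc, Nat.choose_succ_succ]

lemma sum_powersetCard_of_subset {S T : Finset α} (h : S ⊆ T) (k : ℕ) (c : Finset α → ℂ) :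
    ∑ X ∈ Finset.powersetCard k S, c X =
      ∑ X ∈ Finset.powersetCard k T, ((if X ⊆ S then 1 else 0 : ℝ) : ℂ) * c X := by
  have h1 : Finset.powersetCard k S = (Finset.powersetCard k T).filter (· ⊆ S) := by
    ext X
    simp only [Finset.mem_powersetCard, Finset.mem_filter]
    exact ⟨fun hX => ⟨⟨hX.1.trans h, hX.2⟩, hX.1⟩, fun hX => ⟨hX.2, hX.1.2⟩⟩
  rw [h1, Finset.sum_filter]
  refine Finset.sum_congr rfl fun X _ => ?_
  split_ifs <;> simp

/-- The kernel counting the `s`-sets above `X ∪ X'` is, by Vandermonde's identity, a nonnegative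
combination of the positive semidefinite kernels `[Y ⊆ X ∩ X']`; the terms with `|Y| = k` form a
multiple of the identity. -/
lemma choose_mul_sum_norm_sq_le (T : Finset α) {k s : ℕ} (hks : 2 * k ≤ s) (hst : s ≤ T.card)
    (c : Finset α → ℂ) :
    ((T.card - 2 * k).choose (s - k) : ℝ) * ∑ X ∈ Finset.powersetCard k T, ‖c X‖ ^ 2 ≤
      ∑ S ∈ Finset.powersetCard s T, ‖∑ X ∈ Finset.powersetCard k S, c X‖ ^ 2 := by
  set 𝒳 := Finset.powersetCard k T with h𝒳
  set m := T.card - 2 * k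
  set r := s - 2 * k
  have hL : ∑ S ∈ Finset.powersetCard s T, ‖∑ X ∈ Finset.powersetCard k S, c X‖ ^ 2 =
      ∑ Y ∈ T.powerset, (m.choose (r + Y.card) : ℝ) *
        ‖∑ X ∈ 𝒳, ((if Y ⊆ X then 1 else 0 : ℝ) : ℂ) * c X‖ ^ 2 := by
    have h1 : ∀ S ∈ Finset.powersetCard s T, ‖∑ X ∈ Finset.powersetCard k S, c X‖ ^ 2 =
        (1 : ℝ) * ‖∑ X ∈ 𝒳, ((if X ⊆ S then 1 else 0 : ℝ) : ℂ) * c X‖ ^ 2 := by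
      intro S hS
      rw [one_mul, sum_powersetCard_of_subset (Finset.mem_powersetCard.1 hS).1]
    rw [Finset.sum_congr rfl h1, sum_mul_norm_sum_sq, sum_mul_norm_sum_sq]
    refine Finset.sum_congr rfl fun X hX => Finset.sum_congr rfl fun X' hX' => ?_
    congr 1
    rw [h𝒳, Finset.mem_powersetCard] at hX hX'
    have hu := Finset.card_union_add_card_inter X X'
    have hu2 : (X ∪ X').card ≤ s := by omega
    have hi : (X ∩ X').card ≤ k := hX.2 ▸ Finset.card_le_card Finset.inter_subset_left
    have h2 : ∑ S ∈ Finset.powersetCard s T,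
        (1 : ℝ) * ((if X ⊆ S then 1 else 0) * (if X' ⊆ S then 1 else 0)) =
        (((Finset.powersetCard s T).filter ((X ∪ X') ⊆ ·)).card : ℝ) := by
      rw [Finset.card_filter]
      push_cast
      refine Finset.sum_congr rfl fun S _ => ?_
      simp only [Finset.union_subset_iff]
      split_ifs <;> simp_all
    have h3 : ∑ Y ∈ T.powerset, (m.choose (r + Y.card) : ℝ) *
        ((if Y ⊆ X then 1 else 0) * (if Y ⊆ X' then 1 else 0)) =
        ∑ Y ∈ (X ∩ X').powerset, (m.choose (r + Y.card) : ℝ) := by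
      have h4 : (X ∩ X').powerset = T.powerset.filter fun Y => Y ⊆ X ∧ Y ⊆ X' := by
        ext Y
        simp only [Finset.mem_powerset, Finset.mem_filter, Finset.subset_inter_iff]
        exact ⟨fun h => ⟨h.1.trans hX.1, h⟩, fun h => h.2⟩
      rw [h4, Finset.sum_filter]
      refine Finset.sum_congr rfl fun Y _ => ?_
      split_ifs <;> simp_all
    rw [h2, h3, Finset.card_filter_powersetCard_subset _ _ _ (Finset.union_subset hX.1 hX'.1) hu2,
      ← Nat.cast_sum, sum_powerset_choose_add]
    congr 2 <;> omega
  rw [hL, Finset.mul_sum]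
  have hsub : 𝒳 ⊆ T.powerset := fun X hX =>
    Finset.mem_powerset.2 (Finset.mem_powersetCard.1 hX).1
  refine le_trans ?_ (Finset.sum_le_sum_of_subset_of_nonneg hsub fun _ _ _ => by positivity)
  refine Finset.sum_le_sum fun Y hY => le_of_eq ?_
  have hYc := (Finset.mem_powersetCard.1 hY).2
  rw [hYc, show r + k = s - k by omega, Finset.sum_eq_single_of_mem Y hY]
  · simp
  · intro X hX hXY
    rw [if_neg fun h => hXY (Finset.eq_of_subset_of_card_le h ?_).symm]
    · simp
    · rw [hYc, (Finset.mem_powersetCard.1 hX).2]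

end Kernels

/-- Division-free form of `C(m, r) / C(m + k, r) ≥ 1 - k r / (m + 1)`: a random `r`-set avoids `k`
given points with at least this probability. -/
lemma choose_add_mul_le (m r k : ℕ) :
    (m + k).choose r * (m + 1) ≤ m.choose r * (m + 1) + k * r * (m + k).choose r := by
  induction k with
  | zero => simp
  | succ k ih =>
    rcases r with _ | r
    · simp
    have h1 := Nat.choose_succ_succ (m + k) r
    have h2 := Nat.add_one_mul_choose_eq (m + k) r
    simp only [Nat.succ_eq_add_one] at h1
    rw [← add_assoc]
    generalize (m + k + 1).choose (r + 1) = B' at *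
    generalize (m + k).choose (r + 1) = B at *
    generalize (m + k).choose r = D at *
    subst h1
    nlinarith [Nat.zero_le (k * D), Nat.zero_le (k * r * D), Nat.zero_le (m * D)]

lemma one_sub_le_choose_div {t k s : ℕ} (hks : k ≤ s) (ht : 4 * k ≤ t) (hst : s ≤ t) (ht0 : 0 < t) :
    1 - 2 * ((s : ℝ) * k / t) ≤ ((t - 2 * k).choose (s - k) : ℝ) / (t - k).choose (s - k) := by
  have h := choose_add_mul_le (t - 2 * k) (s - k) k
  rw [show t - 2 * k + k = t - k by omega] at h
  have hpos : (0 : ℝ) < (t - k).choose (s - k) := by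
    exact_mod_cast Nat.choose_pos (by omega)
  have h' : ((t - k).choose (s - k) : ℝ) * ((t - 2 * k : ℕ) + 1) ≤
      (t - 2 * k).choose (s - k) * ((t - 2 * k : ℕ) + 1) +
        k * (s - k : ℕ) * (t - k).choose (s - k) := by exact_mod_cast h
  rw [le_div_iff₀ hpos]
  have ht0' : (0 : ℝ) < t := by exact_mod_cast ht0
  have hm : (t : ℝ) / 2 ≤ ((t - 2 * k : ℕ) : ℝ) + 1 := by
    have : (4 : ℝ) * k ≤ t := by exact_mod_cast ht
    rw [Nat.cast_sub (by omega)]; push_cast; linarith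
  have hs : ((s - k : ℕ) : ℝ) ≤ s := by exact_mod_cast Nat.sub_le s k
  set M := ((t - 2 * k : ℕ) : ℝ) + 1
  set B := ((t - k).choose (s - k) : ℝ)
  set B0 := ((t - 2 * k).choose (s - k) : ℝ)
  have hM : 0 < M := by linarith [half_pos ht0']
  have h3 : (k : ℝ) * (s - k : ℕ) ≤ 2 * ((s : ℝ) * k / t) * M := by
    have : 2 * ((s : ℝ) * k / t) * (t / 2) ≤ 2 * ((s : ℝ) * k / t) * M := by gcongr
    have h5 : 2 * ((s : ℝ) * k / t) * (t / 2) = s * k := by field_simp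
    have h6 : (k : ℝ) * (s - k : ℕ) ≤ k * s := by gcongr
    linarith
  have h4 : (k : ℝ) * (s - k : ℕ) * B ≤ 2 * ((s : ℝ) * k / t) * M * B := by gcongr
  by_contra hcon
  push Not at hcon
  have := mul_lt_mul_of_pos_right hcon hM
  nlinarith

section Indistinguishable

variable {n k : ℕ}

lemma norm_distinctKet_le_one {S : Finset (BitString n)} {s : ℕ} (hS : S.card = s) (hs : 0 < s)
    (hk : 1 ≤ k) : ‖distinctKet k s S‖ ≤ 1 := by
  have h := norm_distinctKet_sq (k := k) (s := s) (S := S) hk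
  have hs' : (0 : ℝ) < s := by exact_mod_cast hs
  have h1 : ‖distinctKet k s S‖ ^ 2 ≤ 1 ^ 2 := by
    rw [h, hS, one_pow, div_le_one (by positivity)]
    exact_mod_cast Nat.descFactorial_le_pow s k
  exact le_of_sq_le_sq h1 (by norm_num)

/-- Everything a measurement sees of `distinctKet` is expressed by the amplitudes of the images of
the `|σ_X⟩`. -/
lemma weight_map_distinctKet {B : Type} [Fintype B] (F : Finset B)
    (V : Ket (Fin k → BitString n) →ₗᵢ[ℂ] Ket B) (s : ℕ) (S : Finset (BitString n)) :
    weight F (V (distinctKet k s S)) = (k.factorial : ℝ) / (s : ℝ) ^ k *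
      ∑ b ∈ F, ‖∑ X ∈ Finset.powersetCard k S, V (sigmaKet k X) b‖ ^ 2 := by
  rw [weight, Finset.mul_sum]
  refine Finset.sum_congr rfl fun b _ => ?_
  rw [distinctKet, map_smul, map_sum, PiLp.smul_apply, norm_smul, mul_pow, Complex.norm_real,
    Real.norm_eq_abs, sq_abs, Real.sq_sqrt (by positivity), WithLp.ofLp_sum, Finset.sum_apply]

/-- One side of the comparison of random subset states with random `|σ_X⟩`, from the lower bound
for the kernel. -/
lemma expect_weight_sigmaKet_le {B : Type} [Fintype B] (F : Finset B)
    (V : Ket (Fin k → BitString n) →ₗᵢ[ℂ] Ket B) {T : Finset (BitString n)} {s t : ℕ}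
    (hT : T.card = t) (hk : 1 ≤ k) (hks : 2 * k ≤ s) (hst : s ≤ t) (hkt : 4 * k ≤ t) :
    Finset.expect (Finset.powersetCard k T) (fun X => weight F (V (sigmaKet k X))) -
      ((k : ℝ) ^ 2 / s + 2 * ((s : ℝ) * k / t)) ≤
    Finset.expect (Finset.powersetCard s T) (fun S => weight F (V (distinctKet k s S))) := by
  have hs : (0 : ℝ) < s := by exact_mod_cast (show 0 < s by omega)
  set E := Finset.expect (Finset.powersetCard k T) (fun X => weight F (V (sigmaKet k X))) with hE
  have hE0 : 0 ≤ E := Finset.expect_nonneg fun X _ => weight_nonneg _ _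
  have hE1 : E ≤ 1 := expect_le_const zero_le_one fun X hX => by
    refine (weight_le_norm_sq _ _).trans_eq ?_
    rw [LinearIsometry.norm_map, norm_sigmaKet (Finset.mem_powersetCard.1 hX).2, one_pow]
  have hEsum : ((t.choose k : ℕ) : ℝ) * E =
      ∑ b ∈ F, ∑ X ∈ Finset.powersetCard k T, ‖V (sigmaKet k X) b‖ ^ 2 := by
    have h := Finset.card_mul_expect (Finset.powersetCard k T)
      (fun X => weight F (V (sigmaKet k X)))
    rw [Finset.card_powersetCard, hT] at h
    rw [hE, h, Finset.sum_comm]; rfl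
  have h1 : (k.factorial : ℝ) / (s : ℝ) ^ k * (((t - 2 * k).choose (s - k) : ℝ) *
      ((t.choose k : ℝ) * E)) / t.choose s ≤
      Finset.expect (Finset.powersetCard s T) (fun S => weight F (V (distinctKet k s S))) := by
    rw [Finset.expect_eq_sum_div_card, Finset.card_powersetCard, hT]
    gcongr
    simp only [weight_map_distinctKet]
    rw [← Finset.mul_sum, Finset.sum_comm]
    gcongr
    rw [hEsum, Finset.mul_sum]
    refine Finset.sum_le_sum fun b _ => ?_
    rw [← hT]
    exact choose_mul_sum_norm_sq_le T hks (hT ▸ hst) fun X => V (sigmaKet k X) b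
  refine le_trans ?_ h1
  have h2 : (k.factorial : ℝ) / (s : ℝ) ^ k * (((t - 2 * k).choose (s - k) : ℝ) *
      ((t.choose k : ℝ) * E)) / t.choose s = ((s.descFactorial k : ℝ) / (s : ℝ) ^ k) *
      (((t - 2 * k).choose (s - k) : ℝ) / (t - k).choose (s - k)) * E := by
    have h3 := Nat.choose_mul (n := t) (show k ≤ s by omega)
    have h3' : (t.choose s : ℝ) * s.choose k = t.choose k * (t - k).choose (s - k) := by
      exact_mod_cast h3
    have h4 : (0 : ℝ) < t.choose s := by exact_mod_cast Nat.choose_pos hst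
    have h5 : (0 : ℝ) < (t - k).choose (s - k) := by exact_mod_cast Nat.choose_pos (by omega)
    rw [Nat.descFactorial_eq_factorial_mul_choose]
    push_cast
    field_simp
    linear_combination -(((t - 2 * k).choose (s - k) : ℝ) * E) * h3'
  rw [h2]
  have h6 := one_sub_le_descFactorial_div (k := k) (s := s) (by omega) (by omega)
  have h7 := one_sub_le_choose_div (k := k) (by omega) hkt hst (by omega)
  have h8 : (s.descFactorial k : ℝ) / (s : ℝ) ^ k ≤ 1 := by
    rw [div_le_one (by positivity)]
    exact_mod_cast Nat.descFactorial_le_pow s k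
  have h9 : 0 ≤ (s.descFactorial k : ℝ) / (s : ℝ) ^ k := by positivity
  have h10 : 0 ≤ ((t - 2 * k).choose (s - k) : ℝ) / (t - k).choose (s - k) := by positivity
  have h11 : ((t - 2 * k).choose (s - k) : ℝ) / (t - k).choose (s - k) ≤ 1 := by
    apply div_le_one_of_le₀ _ (by positivity)
    exact_mod_cast Nat.choose_le_choose _ (by omega)
  set u := (s.descFactorial k : ℝ) / (s : ℝ) ^ k
  set v := ((t - 2 * k).choose (s - k) : ℝ) / (t - k).choose (s - k)
  have h12 : 1 - ((k : ℝ) ^ 2 / s + 2 * ((s : ℝ) * k / t)) ≤ u * v := by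
    nlinarith [mul_nonneg (sub_nonneg.2 h8) (sub_nonneg.2 h11)]
  have h13 : 0 ≤ (k : ℝ) ^ 2 / s + 2 * ((s : ℝ) * k / t) := by positivity
  nlinarith [mul_le_mul_of_nonneg_right h12 hE0]

/-- Without oracle, copies of `|S⟩` for a random `S ⊆ T` and the state `|σ_X⟩` for a random
`X ⊆ T` are hard to tell apart. The lower bound for the complementary event gives the upper
bound. -/
lemma abs_expect_weight_distinctKet_sub_le {B : Type} [Fintype B] (F : Finset B)
    (V : Ket (Fin k → BitString n) →ₗᵢ[ℂ] Ket B) {T : Finset (BitString n)} {s t : ℕ}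
    (hT : T.card = t) (hk : 1 ≤ k) (hks : 2 * k ≤ s) (hst : s ≤ t) (hkt : 4 * k ≤ t) :
    |Finset.expect (Finset.powersetCard s T) (fun S => weight F (V (distinctKet k s S))) -
      Finset.expect (Finset.powersetCard k T) (fun X => weight F (V (sigmaKet k X)))| ≤
      (k : ℝ) ^ 2 / s + 2 * ((s : ℝ) * k / t) := by
  classical
  have h1 := expect_weight_sigmaKet_le F V hT hk hks hst hkt
  have h2 := expect_weight_sigmaKet_le Fᶜ V hT hk hks hst hkt
  have h3 : Finset.expect (Finset.powersetCard k T) (fun X => weight Fᶜ (V (sigmaKet k X))) =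
      1 - Finset.expect (Finset.powersetCard k T) (fun X => weight F (V (sigmaKet k X))) := by
    rw [← Finset.expect_const (Finset.powersetCard_nonempty.2 (show k ≤ T.card by omega)) (1 : ℝ),
      ← Finset.expect_sub_distrib]
    refine Finset.expect_congr rfl fun X hX => ?_
    rw [weight_compl, LinearIsometry.norm_map, norm_sigmaKet (Finset.mem_powersetCard.1 hX).2,
      one_pow]
  have h4 : Finset.expect (Finset.powersetCard s T) (fun S => weight Fᶜ (V (distinctKet k s S))) ≤
      1 - Finset.expect (Finset.powersetCard s T)
        (fun S => weight F (V (distinctKet k s S))) := by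
    rw [← Finset.expect_const (Finset.powersetCard_nonempty.2 (show s ≤ T.card by omega)) (1 : ℝ),
      ← Finset.expect_sub_distrib]
    refine Finset.expect_le_expect fun S hS => ?_
    rw [weight_compl, LinearIsometry.norm_map]
    have := norm_distinctKet_le_one (k := k) (Finset.mem_powersetCard.1 hS).2 (by omega) hk
    nlinarith [norm_nonneg (distinctKet k s S)]
  rw [abs_le]
  constructor <;> linarith

end Indistinguishable

/-! ### Fourier analysis on random subsets with independent membership -/

section Bernoulli

variable {α : Type} [DecidableEq α]

/-- The probability that the random subset of `T` containing each element independently with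
probability `p` equals `S`. -/
def bernoulliWeight (p : ℝ) (T S : Finset α) : ℝ := p ^ S.card * (1 - p) ^ (T \ S).card

/-- The (unnormalized) `p`-biased Fourier character `S ↦ ∏_{x ∈ Y} (1_S(x) - p)`. -/
def biasedChar (p : ℝ) (Y S : Finset α) : ℝ := ∏ x ∈ Y, ((if x ∈ S then 1 else 0) - p)

lemma bernoulliWeight_nonneg {p : ℝ} (hp0 : 0 ≤ p) (hp1 : p ≤ 1) (T S : Finset α) :
    0 ≤ bernoulliWeight p T S :=
  mul_nonneg (pow_nonneg hp0 _) (pow_nonneg (sub_nonneg.2 hp1) _)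

lemma biasedChar_eq_prod_mul_prod (p : ℝ) {Y S T : Finset α} (hY : Y ⊆ T) (hS : S ⊆ T) :
    biasedChar p Y S = (∏ x ∈ S, if x ∈ Y then 1 - p else 1) *
      ∏ x ∈ T \ S, if x ∈ Y then -p else 1 := by
  have h1 : biasedChar p Y S =
      ∏ x ∈ T, if x ∈ Y then ((if x ∈ S then (1 : ℝ) else 0) - p) else 1 := by
    rw [Finset.prod_ite_mem, Finset.inter_eq_right.2 hY, biasedChar]
  rw [h1, ← Finset.prod_sdiff hS, mul_comm]
  congr 1
  · exact Finset.prod_congr rfl fun x hx => by simp [hx]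
  · exact Finset.prod_congr rfl fun x hx => by simp [(Finset.mem_sdiff.1 hx).2]

/-- Characters of sets disjoint from `y` remain orthogonal when the random set is conditioned to
contain `y`. -/
lemma sum_bernoulliWeight_mul_biasedChar (p : ℝ) {T y Z Z' : Finset α} (hy : y ⊆ T) (hZ : Z ⊆ T)
    (hZ' : Z' ⊆ T) (hyZ : Disjoint y Z) (hyZ' : Disjoint y Z') :
    ∑ S ∈ T.powerset, (if y ⊆ S then bernoulliWeight p T S else 0) *
      (biasedChar p Z S * biasedChar p Z' S) =
      if Z = Z' then p ^ y.card * (p * (1 - p)) ^ Z.card else 0 := by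
  set f : α → ℝ := fun x =>
    p * ((if x ∈ Z then 1 - p else 1) * (if x ∈ Z' then 1 - p else 1)) with hf
  set g : α → ℝ := fun x => (1 - p) * ((if x ∈ y then 0 else 1) *
    ((if x ∈ Z then -p else 1) * (if x ∈ Z' then -p else 1))) with hg
  have h1 : ∀ S ∈ T.powerset, (if y ⊆ S then bernoulliWeight p T S else 0) *
      (biasedChar p Z S * biasedChar p Z' S) = (∏ x ∈ S, f x) * ∏ x ∈ T \ S, g x := by
    intro S hS
    have hS' := Finset.mem_powerset.1 hS
    have h2 : (∏ x ∈ T \ S, if x ∈ y then (0 : ℝ) else 1) = if y ⊆ S then 1 else 0 := by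
      split_ifs with h
      · exact Finset.prod_eq_one fun x hx =>
          if_neg fun hxy => (Finset.mem_sdiff.1 hx).2 (h hxy)
      · obtain ⟨x, hxy, hxS⟩ := Finset.not_subset.1 h
        exact Finset.prod_eq_zero (Finset.mem_sdiff.2 ⟨hy hxy, hxS⟩) (if_pos hxy)
    rw [biasedChar_eq_prod_mul_prod p hZ hS', biasedChar_eq_prod_mul_prod p hZ' hS', hf, hg]
    simp only [Finset.prod_mul_distrib, h2, Finset.prod_const, bernoulliWeight]
    split_ifs <;> ring
  rw [Finset.sum_congr rfl h1, ← Finset.prod_add]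
  have h3 : ∀ x ∈ T, f x + g x = (if x ∈ y then p else 1) *
      (if x ∈ Z then (if x ∈ Z' then p * (1 - p) else 0) else if x ∈ Z' then 0 else 1) := by
    intro x _
    simp only [hf, hg]
    by_cases hxy : x ∈ y
    · simp [hxy, Finset.disjoint_left.1 hyZ hxy, Finset.disjoint_left.1 hyZ' hxy]
    · by_cases hxZ : x ∈ Z <;> by_cases hxZ' : x ∈ Z' <;> simp [hxy, hxZ, hxZ'] <;> ring
  rw [Finset.prod_congr rfl h3]
  split_ifs with hZZ
  · subst hZZ
    rw [Finset.prod_mul_distrib]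
    congr 1
    · rw [Finset.prod_ite_mem, Finset.inter_eq_right.2 hy, Finset.prod_const]
    · rw [Finset.prod_congr rfl (g := fun x => if x ∈ Z then p * (1 - p) else 1)
        fun x _ => by split_ifs <;> rfl]
      rw [Finset.prod_ite_mem, Finset.inter_eq_right.2 hZ, Finset.prod_const]
  · have hex : ∃ x ∈ T, ¬(x ∈ Z ↔ x ∈ Z') := by
      by_contra hcon
      push Not at hcon
      exact hZZ (Finset.ext fun x =>
        ⟨fun h => (hcon x (hZ h)).1 h, fun h => (hcon x (hZ' h)).2 h⟩)
    obtain ⟨x, hxT, hx⟩ := hex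
    apply Finset.prod_eq_zero hxT
    by_cases hxZ : x ∈ Z <;> by_cases hxZ' : x ∈ Z' <;> simp_all

lemma parseval_biasedChar (p : ℝ) {T y : Finset α} (hy : y ⊆ T) (𝒵 : Finset (Finset α))
    (h𝒵 : ∀ Z ∈ 𝒵, Z ⊆ T \ y) (d : Finset α → ℂ) :
    ∑ S ∈ T.powerset, (if y ⊆ S then bernoulliWeight p T S else 0) *
      ‖∑ Z ∈ 𝒵, (biasedChar p Z S : ℂ) * d Z‖ ^ 2 =
    ∑ Z ∈ 𝒵, p ^ y.card * (p * (1 - p)) ^ Z.card * ‖d Z‖ ^ 2 := by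
  rw [sum_mul_norm_sum_sq]
  refine Finset.sum_congr rfl fun Z hZ => ?_
  have hd : ∀ Z ∈ 𝒵, Disjoint y Z := fun Z hZ =>
    (Finset.disjoint_of_subset_left (h𝒵 Z hZ) Finset.sdiff_disjoint).symm
  have hT : ∀ Z ∈ 𝒵, Z ⊆ T := fun Z hZ => (h𝒵 Z hZ).trans Finset.sdiff_subset
  rw [Finset.sum_eq_single_of_mem Z hZ]
  · rw [sum_bernoulliWeight_mul_biasedChar p hy (hT Z hZ) (hT Z hZ) (hd Z hZ) (hd Z hZ), if_pos rfl,
      Complex.mul_conj', ← Complex.ofReal_pow, Complex.ofReal_re]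
  · intro Z' hZ' hne
    rw [sum_bernoulliWeight_mul_biasedChar p hy (hT Z hZ) (hT Z' hZ') (hd Z hZ) (hd Z' hZ'),
      if_neg hne.symm, zero_mul]

lemma indicator_subset_eq_sum_biasedChar (p : ℝ) (X S : Finset α) :
    (if X ⊆ S then 1 else 0 : ℝ) =
      ∑ Y ∈ X.powerset, biasedChar p Y S * p ^ (X.card - Y.card) := by
  have h1 : (if X ⊆ S then 1 else 0 : ℝ) = ∏ x ∈ X, if x ∈ S then 1 else 0 := by
    split_ifs with h
    · exact (Finset.prod_eq_one fun x hx => if_pos (h hx)).symm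
    · obtain ⟨x, hxX, hxS⟩ := Finset.not_subset.1 h
      exact (Finset.prod_eq_zero hxX (if_neg hxS)).symm
  have h2 : ∀ x ∈ X, (if x ∈ S then (1 : ℝ) else 0) = ((if x ∈ S then 1 else 0) - p) + p :=
    fun x _ => by ring
  rw [h1, Finset.prod_congr rfl h2, Finset.prod_add]
  refine Finset.sum_congr rfl fun Y hY => ?_
  rw [Finset.prod_const, Finset.card_sdiff_of_subset (Finset.mem_powerset.1 hY), biasedChar]

/-- The amplitude `∑_{X ⊆ S} c_X` is its top-degree part plus a part of lower degree. -/
lemma sum_powersetCard_eq_top_add_lower (p : ℝ) {S T : Finset α} (hS : S ⊆ T) (k : ℕ)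
    (c : Finset α → ℂ) :
    ∑ X ∈ Finset.powersetCard k S, c X =
      (∑ X ∈ Finset.powersetCard k T, (biasedChar p X S : ℂ) * c X) +
      ∑ Y ∈ T.powerset.filter (·.card < k), (biasedChar p Y S : ℂ) *
        ((p : ℂ) ^ (k - Y.card) * ∑ X ∈ (Finset.powersetCard k T).filter (Y ⊆ ·), c X) := by
  have h1 : ∀ X ∈ Finset.powersetCard k T, ((if X ⊆ S then 1 else 0 : ℝ) : ℂ) * c X =
      (biasedChar p X S : ℂ) * c X +
        ∑ Y ∈ X.ssubsets, (biasedChar p Y S : ℂ) * ((p : ℂ) ^ (k - Y.card) * c X) := by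
    intro X hX
    rw [indicator_subset_eq_sum_biasedChar p X S,
      ← Finset.insert_erase (Finset.mem_powerset_self X),
      Finset.sum_insert (Finset.notMem_erase _ _), ← Finset.ssubsets,
      (Finset.mem_powersetCard.1 hX).2]
    push_cast
    rw [add_mul, Finset.sum_mul]
    congr 1
    · simp
    · exact Finset.sum_congr rfl fun Y _ => by ring
  rw [sum_powersetCard_of_subset hS, Finset.sum_congr rfl h1, Finset.sum_add_distrib]
  congr 1
  simp only [Finset.mul_sum]
  refine Finset.sum_comm' fun X Y => ?_
  simp only [Finset.mem_powersetCard, Finset.mem_ssubsets, Finset.mem_filter, Finset.mem_powerset]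
  constructor
  · rintro ⟨⟨hX, hXc⟩, hYX⟩
    exact ⟨⟨⟨hX, hXc⟩, hYX.subset⟩, hYX.subset.trans hX, hXc ▸ Finset.card_lt_card hYX⟩
  · rintro ⟨⟨⟨hX, hXc⟩, hYX⟩, -, hYc⟩
    refine ⟨⟨hX, hXc⟩, Finset.ssubset_iff_subset_ne.2 ⟨hYX, ?_⟩⟩
    rintro rfl; omega

/-- On the sets containing `y`, a character factors through its part outside `y`. -/
lemma biasedChar_of_superset (p : ℝ) {X S y : Finset α} (hy : y ⊆ S) :
    biasedChar p X S = biasedChar p (X \ y) S * (1 - p) ^ (X ∩ y).card := by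
  rw [biasedChar, ← Finset.sdiff_union_inter X y,
    Finset.prod_union (Finset.disjoint_sdiff_inter X y), Finset.sdiff_union_inter]
  congr 1
  rw [← Finset.prod_const]
  exact Finset.prod_congr rfl fun x hx => by rw [if_pos (hy (Finset.mem_inter.1 hx).2)]

/-- A top-degree amplitude gains little from the information that `S` contains `k + 1` given
points: at least one of them lies outside `X`, which costs a factor `p`. -/
lemma sum_norm_top_sq_le {p : ℝ} (hp0 : 0 ≤ p) (hp1 : p ≤ 1) {k : ℕ} (hkp : (k + 1) * p ≤ 1)
    {T y : Finset α} (hyT : y ⊆ T) (hyc : y.card = k + 1) (c : Finset α → ℂ) :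
    ∑ S ∈ T.powerset, (if y ⊆ S then bernoulliWeight p T S else 0) *
      ‖∑ X ∈ Finset.powersetCard k T, (biasedChar p X S : ℂ) * c X‖ ^ 2 ≤
    p ^ k * ((k + 1) * p) * ∑ X ∈ Finset.powersetCard k T, ‖c X‖ ^ 2 := by
  set 𝒳 := Finset.powersetCard k T with h𝒳
  set d : Finset α → ℂ := fun Z =>
    ∑ X ∈ 𝒳 with X \ y = Z, (((1 - p) ^ (X ∩ y).card : ℝ) : ℂ) * c X with hd
  have hmap : ∀ X ∈ 𝒳, X \ y ∈ (T \ y).powerset := fun X hX =>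
    Finset.mem_powerset.2 (Finset.sdiff_subset_sdiff (Finset.mem_powersetCard.1 hX).1 subset_rfl)
  have h1 : ∀ S ∈ T.powerset, (if y ⊆ S then bernoulliWeight p T S else 0) *
      ‖∑ X ∈ 𝒳, (biasedChar p X S : ℂ) * c X‖ ^ 2 =
      (if y ⊆ S then bernoulliWeight p T S else 0) *
      ‖∑ Z ∈ (T \ y).powerset, (biasedChar p Z S : ℂ) * d Z‖ ^ 2 := by
    intro S _
    split_ifs with hyS
    · congr 3
      rw [← Finset.sum_fiberwise_of_maps_to hmap]
      refine Finset.sum_congr rfl fun Z _ => ?_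
      rw [hd, Finset.mul_sum]
      refine Finset.sum_congr rfl fun X hX => ?_
      rw [biasedChar_of_superset p hyS, (Finset.mem_filter.1 hX).2]
      push_cast; ring
    · simp
  rw [Finset.sum_congr rfl h1, parseval_biasedChar p hyT _ (fun Z hZ => Finset.mem_powerset.1 hZ),
    ← Finset.sum_fiberwise_of_maps_to hmap, Finset.mul_sum]
  refine Finset.sum_le_sum fun Z hZ => ?_
  have hp1' : 0 ≤ 1 - p := sub_nonneg.2 hp1
  rcases (𝒳.filter fun X => X \ y = Z).eq_empty_or_nonempty with he | ⟨X₀, hX₀⟩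
  · simp [hd, he]
  have hZk : Z.card ≤ k := by
    rw [Finset.mem_filter] at hX₀
    rw [← hX₀.2, ← (Finset.mem_powersetCard.1 hX₀.1).2]
    exact Finset.card_le_card Finset.sdiff_subset
  -- A set `X` with `X \ y = Z` is determined by `X ∩ y`, a subset of `y` of size `k - |Z|`.
  have hcard : (𝒳.filter fun X => X \ y = Z).card ≤ (k + 1) ^ (Z.card + 1) := by
    refine le_trans ?_ (Nat.choose_le_pow (k + 1) (Z.card + 1))
    rw [← Nat.choose_symm (show Z.card + 1 ≤ k + 1 by omega), ← hyc, ← Finset.card_powersetCard]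
    refine Finset.card_le_card_of_injOn (fun X => X ∩ y) ?_ ?_
    · intro X hX
      obtain ⟨hX1, hX2⟩ := Finset.mem_filter.1 hX
      refine Finset.mem_coe.2 (Finset.mem_powersetCard.2 ⟨Finset.inter_subset_right, ?_⟩)
      have := Finset.card_sdiff_add_card_inter X y
      rw [hX2, (Finset.mem_powersetCard.1 hX1).2] at this
      change (X ∩ y).card = y.card - (Z.card + 1)
      omega
    · intro X hX X' hX' h
      have hX2 := (Finset.mem_filter.1 hX).2
      have hX2' := (Finset.mem_filter.1 hX').2
      simp only at h
      rw [← Finset.sdiff_union_inter X y, hX2, h, ← hX2', Finset.sdiff_union_inter]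
  have hdZ : ‖d Z‖ ^ 2 ≤ (k + 1 : ℝ) ^ (Z.card + 1) *
      ∑ X ∈ 𝒳 with X \ y = Z, ‖c X‖ ^ 2 := by
    have h2 : ‖d Z‖ ≤ ∑ X ∈ 𝒳 with X \ y = Z, ‖c X‖ := by
      refine (norm_sum_le _ _).trans (Finset.sum_le_sum fun X _ => ?_)
      rw [norm_mul, Complex.norm_real, Real.norm_of_nonneg (pow_nonneg hp1' _)]
      exact mul_le_of_le_one_left (norm_nonneg _) (pow_le_one₀ hp1' (by linarith))
    calc ‖d Z‖ ^ 2 ≤ (∑ X ∈ 𝒳 with X \ y = Z, ‖c X‖) ^ 2 := by gcongr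
      _ ≤ _ := sq_sum_le_card_mul_sum_sq
      _ ≤ _ := by
        gcongr
        exact_mod_cast hcard
  have hpow : p ^ y.card * (p * (1 - p)) ^ Z.card * (k + 1 : ℝ) ^ (Z.card + 1) ≤
      p ^ k * ((k + 1) * p) := by
    have h3 : p ^ y.card * (p * (1 - p)) ^ Z.card * (k + 1 : ℝ) ^ (Z.card + 1) =
        p ^ k * ((1 - p) ^ Z.card * ((k + 1) * p) ^ Z.card * ((k + 1) * p)) := by
      rw [hyc, mul_pow, mul_pow]; ring
    rw [h3]
    have h4 : (1 - p) ^ Z.card ≤ 1 := pow_le_one₀ hp1' (by linarith)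
    have h5 : ((k + 1) * p) ^ Z.card ≤ 1 := pow_le_one₀ (by positivity) hkp
    refine mul_le_mul_of_nonneg_left ?_ (by positivity)
    exact mul_le_of_le_one_left (by positivity) (mul_le_one₀ h4 (by positivity) h5)
  calc p ^ y.card * (p * (1 - p)) ^ Z.card * ‖d Z‖ ^ 2
      ≤ p ^ y.card * (p * (1 - p)) ^ Z.card * ((k + 1 : ℝ) ^ (Z.card + 1) *
        ∑ X ∈ 𝒳 with X \ y = Z, ‖c X‖ ^ 2) := by gcongr
    _ = (p ^ y.card * (p * (1 - p)) ^ Z.card * (k + 1 : ℝ) ^ (Z.card + 1)) *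
        ∑ X ∈ 𝒳 with X \ y = Z, ‖c X‖ ^ 2 := by ring
    _ ≤ _ := by gcongr

end Bernoulli

section ForgeBernoulli

variable {n k : ℕ}

/-- An isometric image of the orthonormal family `|σ_X⟩`, seen through the amplitudes of its
members at the outcomes in `F`. -/
lemma sum_norm_sum_map_sigmaKet_sq {B : Type} [Fintype B]
    (V : Ket (Fin k → BitString n) →ₗᵢ[ℂ] Ket B) {𝒳 : Finset (Finset (BitString n))}
    (h𝒳 : ∀ X ∈ 𝒳, X.card = k) (F : Finset B) :
    ∑ b ∈ F, ‖∑ X ∈ 𝒳, V (sigmaKet k X) b‖ ^ 2 ≤ 𝒳.card := by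
  have h := weight_le_norm_sq F (V (∑ X ∈ 𝒳, sigmaKet k X))
  rw [LinearIsometry.norm_map, norm_sum_sigmaKet_sq h𝒳, weight] at h
  simpa only [map_sum, WithLp.ofLp_sum, Finset.sum_apply] using h

/-- The lower-degree part of the amplitudes has small total weight. -/
lemma sum_norm_lower_sq_le {p : ℝ} (hp0 : 0 ≤ p) (hp1 : p ≤ 1) {B : Type} [Fintype B]
    (V : Ket (Fin k → BitString n) →ₗᵢ[ℂ] Ket B) (T : Finset (BitString n)) (F : Finset B) :
    ∑ b ∈ F, ∑ S ∈ T.powerset, bernoulliWeight p T S *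
      ‖∑ Y ∈ T.powerset.filter (·.card < k), (biasedChar p Y S : ℂ) *
        ((p : ℂ) ^ (k - Y.card) *
          ∑ X ∈ (Finset.powersetCard k T).filter (Y ⊆ ·), V (sigmaKet k X) b)‖ ^ 2 ≤
    p ^ k * (k * p) * T.card.choose k := by
  have hp1' : 0 ≤ 1 - p := sub_nonneg.2 hp1
  have h1 : ∀ b, ∑ S ∈ T.powerset, bernoulliWeight p T S *
      ‖∑ Y ∈ T.powerset.filter (·.card < k), (biasedChar p Y S : ℂ) *
        ((p : ℂ) ^ (k - Y.card) *
          ∑ X ∈ (Finset.powersetCard k T).filter (Y ⊆ ·), V (sigmaKet k X) b)‖ ^ 2 =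
      ∑ Y ∈ T.powerset.filter (·.card < k), p ^ k * (p ^ (k - Y.card) * (1 - p) ^ Y.card) *
        ‖∑ X ∈ (Finset.powersetCard k T).filter (Y ⊆ ·), V (sigmaKet k X) b‖ ^ 2 := by
    intro b
    have h2 := parseval_biasedChar p (Finset.empty_subset T) (T.powerset.filter (·.card < k))
      (fun Z hZ => by simpa using (Finset.mem_filter.1 hZ).1)
      (fun Y => (p : ℂ) ^ (k - Y.card) *
          ∑ X ∈ (Finset.powersetCard k T).filter (Y ⊆ ·), V (sigmaKet k X) b)
    simp only [Finset.empty_subset, if_true, Finset.card_empty, pow_zero, one_mul] at h2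
    rw [h2]
    refine Finset.sum_congr rfl fun Y hY => ?_
    have hYk := (Finset.mem_filter.1 hY).2
    have h3 : p ^ k = p ^ (k - Y.card) * p ^ Y.card := by rw [← pow_add]; congr 1; omega
    rw [norm_mul, norm_pow, Complex.norm_real, Real.norm_of_nonneg hp0, h3,
      mul_pow p (1 - p)]
    ring
  simp only [h1]
  rw [Finset.sum_comm]
  have h4 : ∀ Y ∈ T.powerset.filter (·.card < k),
      ∑ b ∈ F, p ^ k * (p ^ (k - Y.card) * (1 - p) ^ Y.card) *
        ‖∑ X ∈ (Finset.powersetCard k T).filter (Y ⊆ ·), V (sigmaKet k X) b‖ ^ 2 ≤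
      ∑ X ∈ (Finset.powersetCard k T).filter (Y ⊆ ·),
        p ^ k * (p ^ (k - Y.card) * (1 - p) ^ Y.card) := by
    intro Y _
    rw [← Finset.mul_sum, Finset.sum_const, nsmul_eq_mul, mul_comm (Finset.card _ : ℝ)]
    refine mul_le_mul_of_nonneg_left (sum_norm_sum_map_sigmaKet_sq V ?_ F) (by positivity)
    exact fun X hX => (Finset.mem_powersetCard.1 (Finset.mem_filter.1 hX).1).2
  refine (Finset.sum_le_sum h4).trans ?_
  have h5 : ∀ X ∈ Finset.powersetCard k T, ∑ Y ∈ X.ssubsets,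
      p ^ k * (p ^ (k - Y.card) * (1 - p) ^ Y.card) ≤ p ^ k * (k * p) := by
    intro X hX
    have hXc := (Finset.mem_powersetCard.1 hX).2
    rw [← Finset.mul_sum]
    refine mul_le_mul_of_nonneg_left ?_ (by positivity)
    have h6 := Finset.sum_pow_mul_eq_add_pow (1 - p) p X
    rw [sub_add_cancel, one_pow, ← Finset.insert_erase (Finset.mem_powerset_self X),
      Finset.sum_insert (Finset.notMem_erase _ _), ← Finset.ssubsets, hXc, Nat.sub_self, pow_zero,
      mul_one] at h6
    have h7 := one_add_mul_le_pow (a := -p) (by linarith) k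
    rw [← sub_eq_add_neg 1 p] at h7
    rw [Finset.sum_congr rfl fun Y _ => mul_comm (p ^ (k - Y.card)) ((1 - p) ^ Y.card)]
    linarith
  have h8 := Finset.sum_le_sum h5
  rw [Finset.sum_const, Finset.card_powersetCard, nsmul_eq_mul, mul_comm] at h8
  refine le_trans (le_of_eq ?_) h8
  symm
  refine Finset.sum_comm' fun X Y => ?_
  simp only [Finset.mem_powersetCard, Finset.mem_ssubsets, Finset.mem_filter, Finset.mem_powerset]
  constructor
  · rintro ⟨⟨hX, hXc⟩, hYX⟩
    exact ⟨⟨⟨hX, hXc⟩, hYX.subset⟩, hYX.subset.trans hX, hXc ▸ Finset.card_lt_card hYX⟩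
  · rintro ⟨⟨⟨hX, hXc⟩, hYX⟩, -, hYc⟩
    refine ⟨⟨hX, hXc⟩, Finset.ssubset_iff_subset_ne.2 ⟨hYX, ?_⟩⟩
    rintro rfl; omega

/-- Forging bound, without oracle, for a set `S ⊆ T` whose elements are chosen independently. -/
lemma sum_bernoulliWeight_forge_le {p : ℝ} (hp0 : 0 ≤ p) (hp1 : p ≤ 1) (hkp : (k + 1) * p ≤ 1)
    (hk : 1 ≤ k) {B : Type} [Fintype B] (V : Ket (Fin k → BitString n) →ₗᵢ[ℂ] Ket B)
    (T : Finset (BitString n)) (F : Finset B) (y : B → Finset (BitString n))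
    (hy : ∀ b ∈ F, (y b).card = k + 1) :
    ∑ S ∈ T.powerset, bernoulliWeight p T S *
      ∑ b ∈ F with y b ⊆ S, ‖∑ X ∈ Finset.powersetCard k S, V (sigmaKet k X) b‖ ^ 2 ≤
    6 * k * p * (p ^ k * T.card.choose k) := by
  set top : B → Finset (BitString n) → ℂ := fun b S =>
    ∑ X ∈ Finset.powersetCard k T, (biasedChar p X S : ℂ) * V (sigmaKet k X) b with htop
  set low : B → Finset (BitString n) → ℂ := fun b S =>
    ∑ Y ∈ T.powerset.filter (·.card < k), (biasedChar p Y S : ℂ) *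
        ((p : ℂ) ^ (k - Y.card) *
          ∑ X ∈ (Finset.powersetCard k T).filter (Y ⊆ ·), V (sigmaKet k X) b) with hlow
  have hbound : ∀ b ∈ F, ∑ S ∈ T.powerset, (if y b ⊆ S then bernoulliWeight p T S else 0) *
      ‖top b S‖ ^ 2 ≤ p ^ k * ((k + 1) * p) *
        ∑ X ∈ Finset.powersetCard k T, ‖V (sigmaKet k X) b‖ ^ 2 := by
    intro b hb
    by_cases hyT : y b ⊆ T
    · exact sum_norm_top_sq_le hp0 hp1 hkp hyT (hy b hb) fun X => V (sigmaKet k X) b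
    · rw [Finset.sum_eq_zero]
      · positivity
      · intro S hS
        rw [if_neg fun h => hyT (h.trans (Finset.mem_powerset.1 hS)), zero_mul]
  have htopsum : ∑ b ∈ F, ∑ X ∈ Finset.powersetCard k T, ‖V (sigmaKet k X) b‖ ^ 2 ≤
      T.card.choose k := by
    rw [Finset.sum_comm, ← Finset.card_powersetCard, Finset.card_eq_sum_ones, Nat.cast_sum]
    refine Finset.sum_le_sum fun X hX => ?_
    have h := sum_norm_sum_map_sigmaKet_sq V (𝒳 := {X})
      (by simpa using (Finset.mem_powersetCard.1 hX).2) F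
    simpa using h
  calc ∑ S ∈ T.powerset, bernoulliWeight p T S *
      ∑ b ∈ F with y b ⊆ S, ‖∑ X ∈ Finset.powersetCard k S, V (sigmaKet k X) b‖ ^ 2
      ≤ ∑ S ∈ T.powerset, ∑ b ∈ F,
        (2 * ((if y b ⊆ S then bernoulliWeight p T S else 0) * ‖top b S‖ ^ 2) +
          2 * (bernoulliWeight p T S * ‖low b S‖ ^ 2)) := by
        refine Finset.sum_le_sum fun S hS => ?_
        have hw := bernoulliWeight_nonneg hp0 hp1 T S
        rw [Finset.sum_filter, Finset.mul_sum]
        refine Finset.sum_le_sum fun b _ => ?_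
        split_ifs with hyS
        · rw [sum_powersetCard_eq_top_add_lower p (Finset.mem_powerset.1 hS)]
          have h1 : ‖top b S + low b S‖ ^ 2 ≤ 2 * ‖top b S‖ ^ 2 + 2 * ‖low b S‖ ^ 2 := by
            have h2 := norm_add_le (top b S) (low b S)
            nlinarith [sq_nonneg (‖top b S‖ - ‖low b S‖), norm_nonneg (top b S + low b S)]
          calc _ ≤ bernoulliWeight p T S * (2 * ‖top b S‖ ^ 2 + 2 * ‖low b S‖ ^ 2) := by gcongr
            _ = _ := by ring
        · rw [mul_zero, zero_mul, mul_zero, zero_add]; positivity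
    _ = 2 * ∑ b ∈ F, ∑ S ∈ T.powerset,
          (if y b ⊆ S then bernoulliWeight p T S else 0) * ‖top b S‖ ^ 2 +
        2 * ∑ b ∈ F, ∑ S ∈ T.powerset, bernoulliWeight p T S * ‖low b S‖ ^ 2 := by
        rw [Finset.sum_comm]
        simp only [Finset.sum_add_distrib, Finset.mul_sum]
    _ ≤ 2 * (p ^ k * ((k + 1) * p) * T.card.choose k) +
        2 * (p ^ k * (k * p) * T.card.choose k) := by
        gcongr
        · refine (Finset.sum_le_sum hbound).trans ?_
          rw [← Finset.mul_sum]
          gcongr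
        · exact sum_norm_lower_sq_le hp0 hp1 V T F
    _ ≤ 6 * k * p * (p ^ k * T.card.choose k) := by
        have hk' : (1 : ℝ) ≤ k := by exact_mod_cast hk
        have h0 : 0 ≤ p ^ k * p * T.card.choose k := by positivity
        nlinarith [mul_le_mul_of_nonneg_right hk' h0]

end ForgeBernoulli

/-! ### Forging without oracle, for sets of fixed size -/

/-- Chebyshev's inequality for the binomial distribution. -/
lemma one_sub_le_sum_binomial_window {p D : ℝ} (hp0 : 0 ≤ p) (hp1 : p ≤ 1) (hD : 0 < D) (t : ℕ) :
    1 - t * p / D ^ 2 ≤ ∑ r ∈ (Finset.range (t + 1)).filter (fun r : ℕ => |(r : ℝ) - t * p| < D),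
      (t.choose r : ℝ) * (p ^ r * (1 - p) ^ (t - r)) := by
  have hp1' : 0 ≤ 1 - p := sub_nonneg.2 hp1
  set w : ℕ → ℝ := fun r => (t.choose r : ℝ) * (p ^ r * (1 - p) ^ (t - r)) with hw
  have hw0 : ∀ r, 0 ≤ w r := fun r => by positivity
  have hvar : ∑ r ∈ Finset.range (t + 1), ((t : ℝ) * p - r) ^ 2 * w r = t * p * (1 - p) := by
    have h := congrArg (Polynomial.eval p) (bernsteinPolynomial.variance ℝ t)
    simpa [Polynomial.eval_finsetSum, bernsteinPolynomial, hw, mul_assoc] using h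
  have hsum : ∑ r ∈ Finset.range (t + 1), w r = 1 := by
    have h := add_pow p (1 - p) t
    rw [add_sub_cancel, one_pow] at h
    rw [h]
    exact Finset.sum_congr rfl fun r _ => by rw [hw]; ring
  have hsplit := Finset.sum_filter_add_sum_filter_not (Finset.range (t + 1))
    (fun r : ℕ => |(r : ℝ) - t * p| < D) w
  set tail := (Finset.range (t + 1)).filter (fun r : ℕ => ¬ |(r : ℝ) - t * p| < D)
  have htail : D ^ 2 * ∑ r ∈ tail, w r ≤ t * p := by
    rw [Finset.mul_sum]
    calc ∑ r ∈ tail, D ^ 2 * w r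
        ≤ ∑ r ∈ tail, ((t : ℝ) * p - r) ^ 2 * w r := by
          refine Finset.sum_le_sum fun r hr => ?_
          have h1 := not_lt.1 (Finset.mem_filter.1 hr).2
          refine mul_le_mul_of_nonneg_right ?_ (hw0 r)
          rw [← sq_abs ((t : ℝ) * p - r), abs_sub_comm]
          gcongr
      _ ≤ ∑ r ∈ Finset.range (t + 1), ((t : ℝ) * p - r) ^ 2 * w r :=
          Finset.sum_le_sum_of_subset_of_nonneg (Finset.filter_subset _ _)
            fun r _ _ => mul_nonneg (sq_nonneg _) (hw0 r)
      _ = t * p * (1 - p) := hvar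
      _ ≤ t * p := mul_le_of_le_one_right (by positivity) (by linarith)
  have h2 : ∑ r ∈ tail, w r ≤ t * p / D ^ 2 := by
    rw [le_div_iff₀ (by positivity)]; linarith
  linarith

lemma one_add_div_sqrt_pow_le {k : ℕ} {c r : ℝ} (hc : 0 ≤ c) (hr : 0 ≤ r) (hk : c * k ≤ r) :
    (1 + c / r) ^ k ≤ 1 + 2 * c * (k / r) := by
  have h0 : (0 : ℝ) ≤ c * k / r := by positivity
  have h1 : c * k / r ≤ 1 := div_le_one_of_le₀ hk hr
  have h2 : (1 + c / r) ^ k ≤ Real.exp (c * k / r) := by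
    calc (1 + c / r) ^ k ≤ Real.exp (c / r) ^ k := by
          gcongr
          linarith [Real.add_one_le_exp (c / r)]
      _ = Real.exp (c * k / r) := by rw [← Real.exp_nat_mul]; congr 1; ring
  have h3 := Real.abs_exp_sub_one_le (x := c * k / r) (by rw [abs_of_nonneg h0]; exact h1)
  rw [abs_of_nonneg h0] at h3
  have h4 := le_abs_self (Real.exp (c * k / r) - 1)
  have h5 : 2 * (c * k / r) = 2 * c * (k / r) := by ring
  linarith

section Forge

variable {n k : ℕ}

lemma sqrt_natCast_le (s : ℕ) : √(s : ℝ) ≤ s := by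
  refine Real.sqrt_le_iff.2 ⟨Nat.cast_nonneg s, ?_⟩
  exact_mod_cast Nat.le_self_pow two_ne_zero s

lemma sq_div_le_div_sqrt {s : ℕ} (hk : (k : ℝ) ≤ √s) : (k : ℝ) ^ 2 / s ≤ k / √s := by
  have h : (k : ℝ) ^ 2 / s = (k / √s) ^ 2 := by rw [div_pow, Real.sq_sqrt (Nat.cast_nonneg s)]
  rw [h, sq]
  exact mul_le_of_le_one_right (by positivity) (div_le_one_of_le₀ hk (Real.sqrt_nonneg _))

/-- Enlarging `S` by `O(√s)` elements hardly changes the state. -/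
lemma norm_distinctKet_sub_sq_le {s r : ℕ} {S S' : Finset (BitString n)} (h : S ⊆ S')
    (hS : S.card = s) (hS' : S'.card = r) (hs : 0 < s) (hks : 4 * (k : ℝ) ≤ √s)
    (hr : (r : ℝ) ≤ s + 4 * √s) :
    ‖distinctKet k s S' - distinctKet k s S‖ ^ 2 ≤ 9 * (k / √(s : ℝ)) := by
  have hs' : (0 : ℝ) < s := by exact_mod_cast hs
  have hsq : 0 < √(s : ℝ) := Real.sqrt_pos.2 hs'
  have hss : √(s : ℝ) * √s = s := Real.mul_self_sqrt hs'.le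
  have hk0 : (0 : ℝ) ≤ k := Nat.cast_nonneg k
  have hs1 : √(s : ℝ) ≤ s := sqrt_natCast_le s
  have hks' : k ≤ s := by
    have : (k : ℝ) ≤ s := by linarith
    exact_mod_cast this
  rw [norm_distinctKet_sub_sq h, hS, hS', sub_div]
  have h1 := one_sub_le_descFactorial_div hks' hs
  have h2 := sq_div_le_div_sqrt (k := k) (s := s) (by linarith)
  have h3 : (r.descFactorial k : ℝ) / (s : ℝ) ^ k ≤ 1 + 2 * 4 * (k / √s) := by
    refine le_trans ?_ (one_add_div_sqrt_pow_le (by norm_num) hsq.le hks)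
    rw [div_le_iff₀ (by positivity), ← mul_pow]
    have h4 : (1 + 4 / √(s : ℝ)) * s = s + 4 * √s := by
      rw [add_mul, one_mul, div_mul_eq_mul_div, mul_div_assoc]
      congr 2
      rw [div_eq_iff hsq.ne', hss]
    rw [h4]
    calc (r.descFactorial k : ℝ) ≤ (r : ℝ) ^ k := by exact_mod_cast Nat.descFactorial_le_pow r k
      _ ≤ _ := by gcongr
  linarith

/-- Forging from sets of size `s` is hardly easier than forging from slightly larger sets of size
`r`: the state of the smaller set is almost that of the larger one, which has more elements to
name. -/
lemma expect_weight_distinctKet_le_of_size {B : Type} [Fintype B]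
    (V : Ket (Fin k → BitString n) →ₗᵢ[ℂ] Ket B) {T : Finset (BitString n)} {s r : ℕ}
    (hrT : r ≤ T.card) (hs : 0 < s) (hsr : s ≤ r) (hks : 4 * (k : ℝ) ≤ √s)
    (hr : (r : ℝ) ≤ s + 4 * √s) (F : Finset B) (y : B → Finset (BitString n)) :
    Finset.expect (Finset.powersetCard s T)
      (fun S => weight (F.filter (y · ⊆ S)) (V (distinctKet k s S))) ≤
    2 * Finset.expect (Finset.powersetCard r T)
      (fun S => weight (F.filter (y · ⊆ S)) (V (distinctKet k s S))) + 18 * (k / √(s : ℝ)) := by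
  have h1 : ∀ S ∈ Finset.powersetCard s T,
      weight (F.filter (y · ⊆ S)) (V (distinctKet k s S)) ≤
      Finset.expect (Finset.powersetCard (r - s) (T \ S)) (fun R =>
        2 * weight (F.filter (y · ⊆ S ∪ R)) (V (distinctKet k s (S ∪ R))) +
          18 * (k / √(s : ℝ))) := by
    intro S hS
    obtain ⟨hST, hSc⟩ := Finset.mem_powersetCard.1 hS
    have hcard : (T \ S).card = T.card - s := by rw [Finset.card_sdiff_of_subset hST, hSc]
    have hne : (Finset.powersetCard (r - s) (T \ S)).Nonempty :=
      Finset.powersetCard_nonempty.2 (by omega)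
    rw [← Finset.expect_const hne (weight (F.filter (y · ⊆ S)) (V (distinctKet k s S)))]
    refine Finset.expect_le_expect fun R hR => ?_
    obtain ⟨hRS, hRc⟩ := Finset.mem_powersetCard.1 hR
    have hd : Disjoint S R := (Finset.disjoint_of_subset_left hRS Finset.sdiff_disjoint).symm
    have h2 := weight_le_two_mul_add (F.filter (y · ⊆ S)) (V (distinctKet k s S))
      (V (distinctKet k s (S ∪ R)))
    have h3 := weight_mono (Finset.monotone_filter_right F fun b _ (hb : y b ⊆ S) =>
      hb.trans (Finset.subset_union_left (s₂ := R))) (V (distinctKet k s (S ∪ R)))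
    have h4 := norm_distinctKet_sub_sq_le (k := k) (r := r)
      (Finset.subset_union_left (s₁ := S) (s₂ := R)) hSc
      (by rw [Finset.card_union_of_disjoint hd]; omega) hs hks hr
    rw [← map_sub, LinearIsometry.norm_map, norm_sub_rev] at h2
    linarith
  refine (Finset.expect_le_expect h1).trans_eq ?_
  rw [expect_powersetCard_extend T hsr fun _ S' =>
    2 * weight (F.filter (y · ⊆ S')) (V (distinctKet k s S')) + 18 * (k / √(s : ℝ))]
  have h5 : ∀ S' ∈ Finset.powersetCard r T, Finset.expect (Finset.powersetCard s S') (fun _ =>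
      2 * weight (F.filter (y · ⊆ S')) (V (distinctKet k s S')) + 18 * (k / √(s : ℝ))) =
      2 * weight (F.filter (y · ⊆ S')) (V (distinctKet k s S')) + 18 * (k / √(s : ℝ)) :=
    fun S' hS' => Finset.expect_const
      (Finset.powersetCard_nonempty.2 (by rw [(Finset.mem_powersetCard.1 hS').2]; exact hsr)) _
  rw [Finset.expect_congr rfl h5, Finset.expect_add_distrib, ← Finset.mul_expect,
    Finset.expect_const (Finset.powersetCard_nonempty.2 hrT)]

/-- The bound for independent membership, sorted by the size of the random set. -/
lemma sum_binomial_mul_expect_weight_le {B : Type} [Fintype B]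
    (V : Ket (Fin k → BitString n) →ₗᵢ[ℂ] Ket B) {T : Finset (BitString n)} {s t : ℕ}
    (hT : T.card = t) (hs : 0 < s) (hk : 1 ≤ k) {p : ℝ} (hp0 : 0 ≤ p) (hp1 : p ≤ 1)
    (hkp : (k + 1) * p ≤ 1) (F : Finset B) (y : B → Finset (BitString n))
    (hy : ∀ b ∈ F, (y b).card = k + 1) :
    ∑ r ∈ Finset.range (t + 1), (t.choose r : ℝ) * (p ^ r * (1 - p) ^ (t - r)) *
      Finset.expect (Finset.powersetCard r T)
        (fun S => weight (F.filter (y · ⊆ S)) (V (distinctKet k s S))) ≤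
    6 * k * p * (t * p / s) ^ k := by
  have hs' : (0 : ℝ) < s := by exact_mod_cast hs
  have h := sum_bernoulliWeight_forge_le hp0 hp1 hkp hk V T F y hy
  have h1 : ∀ r ∈ Finset.range (t + 1), (t.choose r : ℝ) * (p ^ r * (1 - p) ^ (t - r)) *
      Finset.expect (Finset.powersetCard r T)
        (fun S => weight (F.filter (y · ⊆ S)) (V (distinctKet k s S))) =
      (k.factorial : ℝ) / (s : ℝ) ^ k * ∑ S ∈ Finset.powersetCard r T, bernoulliWeight p T S *
        ∑ b ∈ F with y b ⊆ S, ‖∑ X ∈ Finset.powersetCard k S, V (sigmaKet k X) b‖ ^ 2 := by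
    intro r _
    have h2 := Finset.card_mul_expect (Finset.powersetCard r T)
        (fun S => weight (F.filter (y · ⊆ S)) (V (distinctKet k s S)))
    rw [Finset.card_powersetCard, hT] at h2
    rw [mul_right_comm, h2, Finset.sum_mul, Finset.mul_sum]
    refine Finset.sum_congr rfl fun S hS => ?_
    obtain ⟨hST, hSc⟩ := Finset.mem_powersetCard.1 hS
    rw [weight_map_distinctKet, bernoulliWeight, Finset.card_sdiff_of_subset hST, hSc, hT]
    ring
  rw [Finset.sum_congr rfl h1, ← Finset.mul_sum, ← hT,
    ← Finset.sum_powerset T fun S => bernoulliWeight p T S *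
        ∑ b ∈ F with y b ⊆ S, ‖∑ X ∈ Finset.powersetCard k S, V (sigmaKet k X) b‖ ^ 2]
  calc _ ≤ (k.factorial : ℝ) / (s : ℝ) ^ k * (6 * k * p * (p ^ k * T.card.choose k)) := by gcongr
    _ = 6 * k * p * (p ^ k * (T.card.descFactorial k) / (s : ℝ) ^ k) := by
        rw [Nat.descFactorial_eq_factorial_mul_choose]; push_cast; ring
    _ ≤ 6 * k * p * (p ^ k * (T.card : ℝ) ^ k / (s : ℝ) ^ k) := by
        gcongr
        exact_mod_cast Nat.descFactorial_le_pow T.card k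
    _ = _ := by rw [div_pow, mul_pow]; ring

/-- For a random `S ⊆ T` with `|S| = s`, a measurement of the distinct part of `k` copies of
`|S⟩` that does not depend on `S` rarely finds `k + 1` elements of `S`. -/
lemma expect_weight_distinctKet_forge_le {B : Type} [Fintype B]
    (V : Ket (Fin k → BitString n) →ₗᵢ[ℂ] Ket B) {T : Finset (BitString n)} {s t : ℕ}
    (hT : T.card = t) (hk : 1 ≤ k) (hks : 4 * (k : ℝ) ≤ √s) (hst : 6 * (s * k) ≤ t)
    (hs : 0 < s) (F : Finset B) (y : B → Finset (BitString n))
    (hy : ∀ b ∈ F, (y b).card = k + 1) :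
    Finset.expect (Finset.powersetCard s T)
      (fun S => weight (F.filter (y · ⊆ S)) (V (distinctKet k s S))) ≤
    18 * (k / √(s : ℝ)) + 432 * ((s : ℝ) * k / t) := by
  set Q : ℕ → ℝ := fun r => Finset.expect (Finset.powersetCard r T)
    (fun S => weight (F.filter (y · ⊆ S)) (V (distinctKet k s S))) with hQ
  change Q s ≤ _
  have hQ0 : ∀ r, 0 ≤ Q r := fun r => Finset.expect_nonneg fun S _ => weight_nonneg _ _
  have hs' : (0 : ℝ) < s := by exact_mod_cast hs
  have hsq : 0 < √(s : ℝ) := Real.sqrt_pos.2 hs'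
  have hss : √(s : ℝ) ^ 2 = s := Real.sq_sqrt hs'.le
  have hs1 : √(s : ℝ) ≤ s := sqrt_natCast_le s
  have hk1 : (1 : ℝ) ≤ k := by exact_mod_cast hk
  have hst' : 6 * ((s : ℝ) * k) ≤ t := by exact_mod_cast hst
  have ht : (0 : ℝ) < t := lt_of_lt_of_le (by positivity) hst'
  -- The mean `s + 2√s` is chosen so that sizes within two standard deviations are at least `s`.
  set p : ℝ := (s + 2 * √s) / t with hp
  have htp : t * p = s + 2 * √s := by rw [hp]; field_simp
  have hp0 : 0 ≤ p := by positivity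
  have hp3 : p ≤ 3 * (s / t) := by
    rw [hp, ← mul_div_assoc]; gcongr; linarith
  have hkp : (k + 1) * p ≤ 1 := by
    calc (k + 1) * p ≤ (2 * k) * (3 * (s / t)) := by gcongr; linarith
      _ = 6 * (s * k) / t := by ring
      _ ≤ 1 := (div_le_one ht).2 hst'
  have hp1 : p ≤ 1 := by nlinarith
  have hwin := one_sub_le_sum_binomial_window hp0 hp1 (D := 2 * √s) (by positivity) t
  have hquarter : (1 : ℝ) / 4 ≤ 1 - t * p / (2 * √s) ^ 2 := by
    rw [htp, mul_pow, hss]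
    have : (s + 2 * √(s : ℝ)) / (2 ^ 2 * s) ≤ 3 / 4 := by
      rw [div_le_div_iff₀ (by positivity) (by norm_num)]; linarith
    linarith
  have hsum := sum_binomial_mul_expect_weight_le V hT hs hk hp0 hp1 hkp F y hy
  have hpk : (t * p / s) ^ k ≤ 3 := by
    have h1 : t * p / s = 1 + 2 / √(s : ℝ) := by
      rw [htp, add_div, div_self hs'.ne']
      congr 1
      rw [div_eq_div_iff hs'.ne' hsq.ne', mul_assoc, ← sq, hss]
    rw [h1]
    refine (one_add_div_sqrt_pow_le (by norm_num) hsq.le (by linarith)).trans ?_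
    have h2 : (k : ℝ) / √s ≤ 1 / 4 := by rw [div_le_div_iff₀ hsq (by norm_num)]; linarith
    linarith
  have hup : 6 * k * p * (t * p / s) ^ k ≤ 54 * ((s : ℝ) * k / t) := by
    calc 6 * k * p * (t * p / s) ^ k ≤ 6 * k * (3 * (s / t)) * 3 := by gcongr
      _ = _ := by ring
  by_contra hcon
  push Not at hcon
  set L := (Q s - 18 * (k / √(s : ℝ))) / 2 with hL
  have hL0 : 216 * ((s : ℝ) * k / t) < L := by rw [hL]; linarith
  have hLpos : 0 < L := lt_of_le_of_lt (by positivity) hL0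
  have hlow : L * (1 / 4) ≤ 6 * k * p * (t * p / s) ^ k := by
    refine le_trans ?_ hsum
    calc L * (1 / 4)
        ≤ L * ∑ r ∈ (Finset.range (t + 1)).filter (fun r : ℕ => |(r : ℝ) - t * p| < 2 * √s),
          (t.choose r : ℝ) * (p ^ r * (1 - p) ^ (t - r)) := by
          gcongr; linarith
      _ ≤ ∑ r ∈ (Finset.range (t + 1)).filter (fun r : ℕ => |(r : ℝ) - t * p| < 2 * √s),
          (t.choose r : ℝ) * (p ^ r * (1 - p) ^ (t - r)) * Q r := by
          rw [Finset.mul_sum]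
          refine Finset.sum_le_sum fun r hr => ?_
          rw [Finset.mem_filter, Finset.mem_range, htp, abs_lt] at hr
          have h1 : s ≤ r := by
            have : (s : ℝ) < r := by linarith [hr.2.1]
            exact_mod_cast this.le
          have h2 := expect_weight_distinctKet_le_of_size V (T := T) (r := r) (by omega) hs h1 hks
            (by linarith [hr.2.2]) F y
          have h3 : L ≤ Q r := by
            change Q s ≤ 2 * Q r + _ at h2
            rw [hL]; linarith
          rw [mul_comm L]
          refine mul_le_mul_of_nonneg_left h3 ?_
          have := sub_nonneg.2 hp1
          positivity
      _ ≤ _ := by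
          refine Finset.sum_le_sum_of_subset_of_nonneg (Finset.filter_subset _ _) fun r _ _ => ?_
          have := sub_nonneg.2 hp1
          have := hQ0 r
          positivity
  linarith

end Forge

/-! ### Unforgeability with the membership oracle -/

section Bounds

variable {n k q : ℕ} {α : Type}

lemma norm_tensorPower_subsetKet {S : Finset (BitString n)} (hS : 0 < S.card) :
    ‖tensorPower (subsetKet S) k‖ = 1 := by
  rw [norm_tensorPower, norm_subsetKet hS, one_pow]

/-- On average over `S`, the membership oracle of `S` can be replaced by that of a random set
`T ⊇ S`. -/
lemma abs_expect_prob_sub_expect_superset_le (A : QueryAlgorithm n k q α) {s t : ℕ} (hst : s ≤ t)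
    (ht : t ≤ 2 ^ n) (hs : 2 * s ≤ 2 ^ n) (φ : Finset (BitString n) → Ket (Fin k → BitString n))
    (hφ : ∀ S, S.card = s → ‖φ S‖ = 1) (E : Finset (BitString n) → Set α) :
    |Finset.expect (Finset.powersetCard s Finset.univ)
        (fun S => A.prob (membership S) (φ S) (E S)) -
      Finset.expect (Finset.powersetCard t Finset.univ) (fun T =>
        Finset.expect (Finset.powersetCard s T) fun S => A.prob (membership T) (φ S) (E S))| ≤
      8 * (q * √(((t : ℝ) - s) / 2 ^ n)) := by
  rw [← expect_powersetCard_extend Finset.univ hst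
    fun S T => A.prob (membership T) (φ S) (E S), ← Finset.expect_sub_distrib]
  refine (abs_expect_le _ _).trans (expect_le_const (by positivity) fun S hS => ?_)
  have hSc := (Finset.mem_powersetCard.1 hS).2
  refine (A.abs_prob_sub_expect_prob_le hSc hst ht (hφ S hSc) (E S)).trans ?_
  have h2s : 2 * (s : ℝ) ≤ 2 ^ n := by exact_mod_cast hs
  have hN : (0 : ℝ) < 2 ^ n := by positivity
  have hts : (0 : ℝ) ≤ (t : ℝ) - s := sub_nonneg.2 (by exact_mod_cast hst)
  have h1 : √(((t : ℝ) - s) / ((2 : ℝ) ^ n - s)) ≤ 2 * √(((t : ℝ) - s) / 2 ^ n) := by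
    refine Real.sqrt_le_iff.2 ⟨by positivity, ?_⟩
    rw [mul_pow, Real.sq_sqrt (by positivity), ← mul_div_assoc,
      div_le_div_iff₀ (by linarith) hN]
    nlinarith [mul_nonneg hts (show (0 : ℝ) ≤ 2 ^ n - 2 * s by linarith), mul_nonneg hts hN.le]
  calc 4 * q * √(((t : ℝ) - s) / ((2 : ℝ) ^ n - s))
      ≤ 4 * q * (2 * √(((t : ℝ) - s) / 2 ^ n)) := by gcongr
    _ = _ := by ring

/-- Outside the range of parameters where `k ≪ √s` and `s k ≪ t`, the bound is at least `1 / 6`,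
so that it holds trivially up to a constant. -/
lemma one_le_forgeBound_of_not {n k s t q : ℕ} (hs : 0 < s) (ht : 0 < t)
    (h : ¬ (4 * (k : ℝ) ≤ √s ∧ 6 * (s * k) ≤ t)) : 1 ≤ 6 * forgeBound n k s t q := by
  have hs' : (0 : ℝ) < √(s : ℝ) := Real.sqrt_pos.2 (by exact_mod_cast hs)
  have ht' : (0 : ℝ) < t := by exact_mod_cast ht
  have h1 : (0 : ℝ) ≤ q * √(((t : ℝ) - s) / 2 ^ n) := by positivity
  have h2 : (0 : ℝ) ≤ q * √(((t : ℝ) - k) / 2 ^ n) := by positivity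
  have h3 : (0 : ℝ) ≤ k / √(s : ℝ) := by positivity
  have h4 : (0 : ℝ) ≤ (s : ℝ) * k / t := by positivity
  unfold forgeBound
  rw [not_and_or, not_le, not_le] at h
  rcases h with h | h
  · have h5 : (1 : ℝ) / 4 ≤ k / √(s : ℝ) := by
      rw [div_le_div_iff₀ (by norm_num) hs']; linarith
    linarith
  · have h' : (t : ℝ) < 6 * (s * k) := by exact_mod_cast h
    have h5 : (1 : ℝ) / 6 ≤ (s : ℝ) * k / t := by
      rw [div_le_div_iff₀ (by norm_num) ht']; linarith
    linarith

lemma forgeProb_nonneg (s : ℕ) (A : QueryAlgorithm n k q (Fin (k + 1) → BitString n)) :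
    0 ≤ forgeProb s A := Finset.expect_nonneg fun _ _ => A.prob_nonneg _ _ _

/-- With the oracle of a fixed `T ⊇ S`, the algorithm is a fixed measurement of copies of `|S⟩`. -/
lemma expect_prob_superset_forge_le (A : QueryAlgorithm n k q (Fin (k + 1) → BitString n))
    {T : Finset (BitString n)} {s t : ℕ} (hT : T.card = t) (hk : 1 ≤ k) (hs : k < s)
    (hks : 4 * (k : ℝ) ≤ √s) (hst : 6 * (s * k) ≤ t) :
    Finset.expect (Finset.powersetCard s T) (fun S =>
      A.prob (membership T) (tensorPower (subsetKet S) k) (distTuples S (k + 1))) ≤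
    38 * (k / √(s : ℝ)) + 864 * ((s : ℝ) * k / t) := by
  classical
  set V := A.run (membership T)
  set F : Finset (RegisterBasis n k A.w) :=
    Finset.univ.filter fun b => Function.Injective (A.out b) with hF
  set y : RegisterBasis n k A.w → Finset (BitString n) := fun b => Finset.univ.image (A.out b)
  have hy : ∀ b ∈ F, (y b).card = k + 1 := fun b hb => by
    rw [Finset.card_image_of_injective _ (Finset.mem_filter.1 hb).2, Finset.card_univ,
      Fintype.card_fin]
  have hmain := expect_weight_distinctKet_forge_le V hT hk hks hst (by omega) F y hy
  have h1 : ∀ S ∈ Finset.powersetCard s T,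
      A.prob (membership T) (tensorPower (subsetKet S) k) (distTuples S (k + 1)) ≤
      2 * weight (F.filter (y · ⊆ S)) (V (distinctKet k s S)) + 2 * (k / √(s : ℝ)) := by
    intro S hS
    have hSc := (Finset.mem_powersetCard.1 hS).2
    have hset : (Finset.univ.filter fun b => A.out b ∈ distTuples S (k + 1)) =
        F.filter (y · ⊆ S) := by
      ext b
      have hb : A.out b ∈ distTuples S (k + 1) ↔
          Function.Injective (A.out b) ∧ ∀ i, A.out b i ∈ S := Iff.rfl
      simp only [hF, y, hb, Finset.mem_filter, Finset.mem_univ, true_and,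
        Finset.image_subset_iff, forall_true_left]
    have h2 := weight_le_two_mul_add (F.filter (y · ⊆ S)) (V (tensorPower (subsetKet S) k))
      (V (distinctKet k s S))
    rw [← map_sub, LinearIsometry.norm_map] at h2
    have h3 := norm_tensorPower_sub_distinctKet_sq_le hSc hk hs.le
    have h4 := sq_div_le_div_sqrt (k := k) (s := s) (by linarith [Nat.cast_nonneg (α := ℝ) k])
    rw [A.prob_eq_weight, hset]
    linarith
  refine (Finset.expect_le_expect h1).trans ?_
  have hne : (Finset.powersetCard s T).Nonempty :=
    Finset.powersetCard_nonempty.2 (by rw [hT]; nlinarith)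
  rw [Finset.expect_add_distrib, ← Finset.mul_expect, Finset.expect_const hne]
  linarith

lemma forgeProb_le {s t : ℕ} (hk : 1 ≤ k) (hks : k < s) (hst : s < t) (ht : t ≤ 2 ^ n)
    (A : QueryAlgorithm n k q (Fin (k + 1) → BitString n)) :
    forgeProb s A ≤ 864 * forgeBound n k s t q := by
  by_cases h : 4 * (k : ℝ) ≤ √s ∧ 6 * (s * k) ≤ t
  · obtain ⟨h1, h2⟩ := h
    have hsk : s ≤ s * k := Nat.le_mul_of_pos_right s hk
    have h3 := abs_expect_prob_sub_expect_superset_le A hst.le ht (by omega)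
      (fun S => tensorPower (subsetKet S) k)
      (fun S hS => norm_tensorPower_subsetKet (by omega)) (fun S => distTuples S (k + 1))
    have h4 : Finset.expect (Finset.powersetCard t (Finset.univ : Finset (BitString n)))
        (fun T => Finset.expect (Finset.powersetCard s T) fun S =>
          A.prob (membership T) (tensorPower (subsetKet S) k) (distTuples S (k + 1))) ≤
        38 * (k / √(s : ℝ)) + 864 * ((s : ℝ) * k / t) :=
      expect_le_const (by positivity) fun T hT =>
        expect_prob_superset_forge_le A (Finset.mem_powersetCard.1 hT).2 hk hks h1 h2
    have h5 := (abs_le.1 h3).2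
    have h6 : (0 : ℝ) ≤ q * √(((t : ℝ) - s) / 2 ^ n) := by positivity
    have h7 : (0 : ℝ) ≤ q * √(((t : ℝ) - k) / 2 ^ n) := by positivity
    have h8 : (0 : ℝ) ≤ k / √(s : ℝ) := by positivity
    rw [forgeProb, forgeBound]
    linarith
  · have h1 := one_le_forgeBound_of_not (n := n) (q := q) (by omega) (by omega) h
    have h2 : forgeProb s A ≤ 1 := expect_le_const zero_le_one fun S hS =>
      A.prob_le_one _ (norm_tensorPower_subsetKet
        (by rw [(Finset.mem_powersetCard.1 hS).2]; omega)) _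
    linarith

/-- With the oracle of a fixed `T` the two kinds of input states are hard to tell apart. -/
lemma abs_expect_prob_superset_sub_le (D : QueryAlgorithm n k q Bool)
    {T : Finset (BitString n)} {s t : ℕ} (hT : T.card = t) (hk : 1 ≤ k) (hs : k < s)
    (hks : 4 * (k : ℝ) ≤ √s) (hst : 6 * (s * k) ≤ t) :
    |Finset.expect (Finset.powersetCard s T) (fun S =>
        D.prob (membership T) (tensorPower (subsetKet S) k) {true}) -
      Finset.expect (Finset.powersetCard k T) (fun X =>
        D.prob (membership T) (sigmaKet k X) {true})| ≤
    3 * (k / √(s : ℝ)) + 2 * ((s : ℝ) * k / t) := by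
  set V := D.run (membership T)
  obtain ⟨F, hF⟩ : ∃ F, ∀ φ, D.prob (membership T) φ {true} = weight F (V φ) :=
    ⟨_, fun φ => D.prob_eq_weight _ φ _⟩
  have hk0 : (0 : ℝ) ≤ k := Nat.cast_nonneg k
  have hsk : s ≤ s * k := Nat.le_mul_of_pos_right s hk
  have h2ks : 2 * k ≤ s := by
    have : 2 * (k : ℝ) ≤ s := by linarith [sqrt_natCast_le s]
    exact_mod_cast this
  simp only [hF]
  have hmain := abs_expect_weight_distinctKet_sub_le F V hT hk h2ks (by omega) (by omega)
  have h4 := sq_div_le_div_sqrt (k := k) (s := s) (by linarith)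
  have h1 : |Finset.expect (Finset.powersetCard s T) (fun S =>
        weight F (V (tensorPower (subsetKet S) k))) -
      Finset.expect (Finset.powersetCard s T) (fun S => weight F (V (distinctKet k s S)))| ≤
      2 * (k / √(s : ℝ)) := by
    rw [← Finset.expect_sub_distrib]
    refine (abs_expect_le _ _).trans (expect_le_const (by positivity) fun S hS => ?_)
    have hSc := (Finset.mem_powersetCard.1 hS).2
    refine (abs_weight_sub_weight_le F ?_ ?_).trans ?_
    · rw [LinearIsometry.norm_map, norm_tensorPower_subsetKet (by omega)]
    · rw [LinearIsometry.norm_map]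
      exact norm_distinctKet_le_one hSc (by omega) hk
    · rw [← map_sub, LinearIsometry.norm_map]
      refine mul_le_mul_of_nonneg_left ?_ (by norm_num)
      refine abs_le_of_sq_le_sq' ?_ (by positivity) |>.2
      refine (norm_tensorPower_sub_distinctKet_sq_le hSc hk hs.le).trans_eq ?_
      rw [div_pow, Real.sq_sqrt (Nat.cast_nonneg s)]
  have h2 := abs_sub_le (Finset.expect (Finset.powersetCard s T) (fun S =>
        weight F (V (tensorPower (subsetKet S) k))))
      (Finset.expect (Finset.powersetCard s T) (fun S => weight F (V (distinctKet k s S))))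
      (Finset.expect (Finset.powersetCard k T) (fun X =>
        weight F (V (sigmaKet k X))))
  linarith

lemma abs_subsetAcceptProb_sub_le {s t : ℕ} (hk : 1 ≤ k) (hks : k < s) (hst : s < t)
    (ht : t ≤ 2 ^ n) (D : QueryAlgorithm n k q Bool) :
    |subsetAcceptProb s D - sigmaAcceptProb D| ≤ 8 * forgeBound n k s t q := by
  by_cases h : 4 * (k : ℝ) ≤ √s ∧ 6 * (s * k) ≤ t
  · obtain ⟨h1, h2⟩ := h
    have hsk : s ≤ s * k := Nat.le_mul_of_pos_right s hk
    have h3 := abs_expect_prob_sub_expect_superset_le D hst.le ht (by omega)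
      (fun S => tensorPower (subsetKet S) k)
      (fun S hS => norm_tensorPower_subsetKet (by omega)) (fun _ => {true})
    have h4 := abs_expect_prob_sub_expect_superset_le D (hks.trans hst).le ht (by omega)
      (fun X => sigmaKet k X) (fun X hX => norm_sigmaKet hX) (fun _ => {true})
    have h5 : |Finset.expect (Finset.powersetCard t (Finset.univ : Finset (BitString n)))
        (fun T => Finset.expect (Finset.powersetCard s T) fun S =>
          D.prob (membership T) (tensorPower (subsetKet S) k) {true}) -
        Finset.expect (Finset.powersetCard t (Finset.univ : Finset (BitString n)))
        (fun T => Finset.expect (Finset.powersetCard k T) fun X =>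
          D.prob (membership T) (sigmaKet k X) {true})| ≤
        3 * (k / √(s : ℝ)) + 2 * ((s : ℝ) * k / t) := by
      rw [← Finset.expect_sub_distrib]
      exact (abs_expect_le _ _).trans (expect_le_const (by positivity) fun T hT =>
        abs_expect_prob_superset_sub_le D (Finset.mem_powersetCard.1 hT).2 hk hks h1 h2)
    have h8 : (0 : ℝ) ≤ k / √(s : ℝ) := by positivity
    have h9 : (0 : ℝ) ≤ (s : ℝ) * k / t := by positivity
    rw [subsetAcceptProb, sigmaAcceptProb, forgeBound]
    rw [abs_le] at h3 h4 h5 ⊢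
    constructor <;> linarith [h3.1, h3.2, h4.1, h4.2, h5.1, h5.2]
  · have h1 := one_le_forgeBound_of_not (n := n) (q := q) (by omega) (by omega) h
    have h2 : subsetAcceptProb s D ≤ 1 := expect_le_const zero_le_one fun S hS =>
      D.prob_le_one _ (norm_tensorPower_subsetKet
        (by rw [(Finset.mem_powersetCard.1 hS).2]; omega)) _
    have h3 : sigmaAcceptProb D ≤ 1 := expect_le_const zero_le_one fun X hX =>
      D.prob_le_one _ (norm_sigmaKet (Finset.mem_powersetCard.1 hX).2) _
    have h4 : 0 ≤ subsetAcceptProb s D := Finset.expect_nonneg fun _ _ => D.prob_nonneg _ _ _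
    have h5 : 0 ≤ sigmaAcceptProb D := Finset.expect_nonneg fun _ _ => D.prob_nonneg _ _ _
    rw [abs_le]
    constructor <;> linarith

end Bounds

/-! ### Negligible functions -/

/-- For nonnegative functions, boundedness of `n ^ c * f n` for all `c` suffices, since `c` may be
raised by one. -/
lemma negligible_iff {f : ℕ → ℝ} (hf : ∀ n, 0 ≤ f n) :
    Negligible f ↔ ∀ c : ℕ, ∀ᶠ n : ℕ in atTop, (n : ℝ) ^ c * f n ≤ 1 := by
  constructor
  · intro h c
    filter_upwards [(h c).eventually (ge_mem_nhds (show (0 : ℝ) < 1 by norm_num))] with n hn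
    exact hn
  · intro h c
    have h0 : Tendsto (fun n : ℕ => ((n : ℝ))⁻¹) atTop (𝓝 0) := tendsto_inv_atTop_nhds_zero_nat
    refine tendsto_of_tendsto_of_tendsto_of_le_of_le' tendsto_const_nhds h0 ?_ ?_
    · exact Eventually.of_forall fun n => mul_nonneg (by positivity) (hf n)
    · filter_upwards [h (c + 1), eventually_gt_atTop 0] with n hn hn0
      have hn0' : (0 : ℝ) < n := by exact_mod_cast hn0
      rw [← one_div, le_div_iff₀ hn0']
      calc (n : ℝ) ^ c * f n * n = (n : ℝ) ^ (c + 1) * f n := by ring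
        _ ≤ 1 := hn

lemma Negligible.sqrt {f : ℕ → ℝ} (hf : ∀ n, 0 ≤ f n) (h : Negligible f) :
    Negligible fun n => √(f n) := by
  rw [negligible_iff fun n => Real.sqrt_nonneg _]
  intro c
  filter_upwards [(negligible_iff hf).1 h (2 * c)] with n hn
  have h1 : (n : ℝ) ^ c * √(f n) = √((n : ℝ) ^ (2 * c) * f n) := by
    rw [Real.sqrt_mul (by positivity), mul_comm 2, pow_mul, Real.sqrt_sq (by positivity)]
  rw [h1]
  exact Real.sqrt_le_one.2 hn

lemma Negligible.polyBounded_mul {f : ℕ → ℝ} (hf : ∀ n, 0 ≤ f n) (h : Negligible f) {k : ℕ → ℕ}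
    (hk : PolyBounded k) : Negligible fun n => (k n : ℝ) * f n := by
  rw [negligible_iff fun n => mul_nonneg (Nat.cast_nonneg _) (hf n)]
  intro c
  obtain ⟨d, hd⟩ := hk
  filter_upwards [(negligible_iff hf).1 h (c + d), hd] with n hn hdn
  have hdn' : (k n : ℝ) ≤ (n : ℝ) ^ d := by exact_mod_cast hdn
  calc (n : ℝ) ^ c * (k n * f n) ≤ (n : ℝ) ^ c * ((n : ℝ) ^ d * f n) := by
        have := hf n
        gcongr
    _ = (n : ℝ) ^ (c + d) * f n := by ring
    _ ≤ 1 := hn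

lemma Superpolynomial.negligible_inv {s : ℕ → ℕ} (hs : Superpolynomial s) :
    Negligible fun n => ((s n : ℝ))⁻¹ := by
  rw [negligible_iff fun n => by positivity]
  intro c
  filter_upwards [hs c] with n hn
  have hn' : (n : ℝ) ^ c ≤ s n := by exact_mod_cast hn
  rw [← div_eq_mul_inv]
  exact div_le_one_of_le₀ hn' (Nat.cast_nonneg _)

lemma negligible_of_le {f g : ℕ → ℝ} (hf : ∀ n, 0 ≤ f n) (hfg : ∀ᶠ n in atTop, f n ≤ g n)
    (hg : Negligible g) : Negligible f := by
  intro c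
  refine tendsto_of_tendsto_of_tendsto_of_le_of_le' tendsto_const_nhds (hg c) ?_ ?_
  · exact Eventually.of_forall fun n => mul_nonneg (by positivity) (hf n)
  · filter_upwards [hfg] with n hn
    gcongr

end

theorem mainTheorem1 :
    (∃ C : ℝ, 0 < C ∧ ∀ n k s t q : ℕ, 1 ≤ k → k < s → s < t → t ≤ 2 ^ n →
      ∀ A : QueryAlgorithm n k q (Fin (k + 1) → BitString n),
        forgeProb s A ≤ C * forgeBound n k s t q) ∧
    (∃ C : ℝ, 0 < C ∧ ∀ n k s t q : ℕ, 1 ≤ k → k < s → s < t → t ≤ 2 ^ n →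
      ∀ D : QueryAlgorithm n k q Bool,
        |subsetAcceptProb s D - sigmaAcceptProb D| ≤ C * forgeBound n k s t q) ∧
    (∀ k q s t : ℕ → ℕ,
      PolyBounded k → PolyBounded q → Superpolynomial s → Superpolynomial t →
      (∀ᶠ n in atTop, 1 ≤ k n ∧ k n < s n ∧ s n < t n ∧ t n ≤ 2 ^ n) →
      Negligible (fun n => (s n : ℝ) / t n) →
      Negligible (fun n => (t n : ℝ) / 2 ^ n) →
      ∀ A : (n : ℕ) → QueryAlgorithm n (k n) (q n) (Fin (k n + 1) → BitString n),
        Negligible (fun n => forgeProb (s n) (A n))) := by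
  refine ⟨⟨864, by norm_num, fun n k s t q hk hks hst ht A => forgeProb_le hk hks hst ht A⟩,
    ⟨8, by norm_num, fun n k s t q hk hks hst ht D => abs_subsetAcceptProb_sub_le hk hks hst ht D⟩,
    ?_⟩
  intro k q s t hk hq hs _ hparam hst ht A
  have h1 : Negligible fun n => (q n : ℝ) * √((t n : ℝ) / 2 ^ n) :=
    (ht.sqrt fun n => by positivity).polyBounded_mul (fun n => Real.sqrt_nonneg _) hq
  have h2 : Negligible fun n => (k n : ℝ) * √((s n : ℝ)⁻¹) :=
    (hs.negligible_inv.sqrt fun n => by positivity).polyBounded_mul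
      (fun n => Real.sqrt_nonneg _) hk
  have h3 : Negligible fun n => (k n : ℝ) * ((s n : ℝ) / t n) :=
    hst.polyBounded_mul (fun n => by positivity) hk
  have h4 : Negligible fun n => 864 * (((q n : ℝ) * √((t n : ℝ) / 2 ^ n) +
      (q n : ℝ) * √((t n : ℝ) / 2 ^ n)) + (k n : ℝ) * √((s n : ℝ)⁻¹) +
      (k n : ℝ) * ((s n : ℝ) / t n)) :=
    (((h1.add h1).add h2).add h3).const_mul 864
  refine negligible_of_le (fun n => forgeProb_nonneg _ _) ?_ h4
  filter_upwards [hparam] with n hn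
  refine (forgeProb_le hn.1 hn.2.1 hn.2.2.1 hn.2.2.2 (A n)).trans ?_
  rw [forgeBound]
  have h5 : √(((t n : ℝ) - s n) / 2 ^ n) ≤ √((t n : ℝ) / 2 ^ n) := by
    gcongr; exact sub_le_self _ (Nat.cast_nonneg _)
  have h6 : √(((t n : ℝ) - k n) / 2 ^ n) ≤ √((t n : ℝ) / 2 ^ n) := by
    gcongr; exact sub_le_self _ (Nat.cast_nonneg _)
  have h7 : (k n : ℝ) / √(s n : ℝ) = k n * √((s n : ℝ)⁻¹) := by
    rw [Real.sqrt_inv, div_eq_mul_inv]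
  have h8 : (s n : ℝ) * k n / t n = k n * ((s n : ℝ) / t n) := by ring
  rw [h7, h8]
  gcongr
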